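/- Let $k$ be an algebraically closed field of arbitrary characteristic. For a commutative $k$-algebra $A$, an \emph{exponential map} on $A$ is a $k$-algebra homomorphism $\varphi=\varphi_U:A\to A[U]$ into the polynomial ring in one indeterminate $U$ such that (i) $\varepsilon_0\varphi_U=\mathrm{id}_A$, where $\varepsilon_0:A[U]\to A$ is evaluation at $U=0$; (ii) $\varphi_S\varphi_U=\varphi_{S+U}$ as maps $A\to A[S,U]$, where $\varphi_S$ is extended to a homomorphism $A[U]\to A[S,U]$ by $\varphi_S(U)=U$. The ring of $\varphi$-invariants is $A^\varphi=\{a\in A:\varphi(a)=a\}$, and the \emph{AK invariant} of $A$ is the $k$-subalgebra $$\mathrm{AK}(A)=\bigcap_{\varphi}A^{\varphi},$$ the intersection being taken over all exponential maps $\varphi$ on $A$. \textbf{Theorem.} Let $R=k[X,Y,Z,T]/(X+X^2Y+Z^2+T^3)$ and let $x\in R$ be the coset of $X$. Then $\mathrm{AK}(R)=k[x]$, the $k$-subalgebra of $R$ generated by $x$. -/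

import Mathlib

open Polynomial

/-- Let `A` be a commutative `k`-algebra and `φ = φ_U : A → A[U]` a `k`-algebra homomorphism.
It is an exponential map if evaluation at `U = 0` after `φ` is the identity and if
`φ_S φ_U = φ_{S+U}`. Here `A[S, U]` is written as `A[S][U]` (that is, `A[X][X]` with inner
variable `S = C X` and outer variable `U = X`), so that the extension `A[U] → A[S, U]` of `φ_S`
with `U ↦ U` is `φ` applied to the coefficients. -/
structure IsExponentialMap {k A : Type*} [CommRing k] [CommRing A] [Algebra k A]
    (φ : A →ₐ[k] A[X]) : Prop where
  eval_zero : ∀ a : A, (φ a).eval 0 = a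
  comp_eq : ∀ a : A,
    (φ a).map (φ : A →+* A[X]) = aeval (C X + X : A[X][X]) (φ a)

/-- The ring of `φ`-invariants `A^φ = {a | φ a = a}`, where `A` sits in `A[U]` as constants. -/
noncomputable def expInvariants {k A : Type*} [CommRing k] [CommRing A] [Algebra k A]
    (φ : A →ₐ[k] A[X]) : Subalgebra k A :=
  AlgHom.equalizer φ (CAlgHom : A →ₐ[k] A[X])

/-- The AK invariant of the `k`-algebra `A`: the intersection of the rings of invariants of all
exponential maps on `A`. -/
noncomputable def akInvariant (k A : Type*) [CommRing k] [CommRing A] [Algebra k A] :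
    Subalgebra k A :=
  ⨅ φ : {φ : A →ₐ[k] A[X] // IsExponentialMap φ}, expInvariants φ.1

/-- The polynomial `X + X² Y + Z² + T³`, with `X, Y, Z, T` the variables `0, 1, 2, 3`. -/
noncomputable def russellPoly (k : Type*) [CommRing k] : MvPolynomial (Fin 4) k :=
  MvPolynomial.X 0 + MvPolynomial.X 0 ^ 2 * MvPolynomial.X 1 + MvPolynomial.X 2 ^ 2
    + MvPolynomial.X 3 ^ 3

/-- The coordinate ring `k[X, Y, Z, T] / (X + X² Y + Z² + T³)`, with the quotient ring structure
and the quotient `k`-algebra structure. -/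
def RussellRing (k : Type*) [CommRing k] : Type _ :=
  MvPolynomial (Fin 4) k ⧸ Ideal.span {russellPoly k}

noncomputable instance RussellRing.instCommRing (k : Type*) [CommRing k] :
    CommRing (RussellRing k) :=
  inferInstanceAs (CommRing (MvPolynomial (Fin 4) k ⧸ Ideal.span {russellPoly k}))

noncomputable instance RussellRing.instAlgebra (k : Type*) [CommRing k] :
    Algebra k (RussellRing k) :=
  inferInstanceAs (Algebra k (MvPolynomial (Fin 4) k ⧸ Ideal.span {russellPoly k}))

/-- The coset `x` of `X`. -/
noncomputable def russellX (k : Type*) [CommRing k] : RussellRing k :=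
  Ideal.Quotient.mk (Ideal.span {russellPoly k}) (MvPolynomial.X 0)

/-! On a domain the U-degree of φ(a) behaves like a degree function. Hence the ring of invariants is
closed under nonzero divisors, is algebraically closed in A, and loses at most one in transcendence
degree.

AK(R) ⊆ k[x]: two explicit exponential maps fix x; one fixes t and sends z to z + x²U, the other
sends t to t + x²U, with y corrected to preserve the relation. If a lies in AK(R), some xⁿa is a
polynomial in x, t, z; invariance under the two maps removes z and t, and powers of x cancel.

k[x] ⊆ AK(R) (`RussellModel.x_mem_expInvariants`): suppose φ moves x. With weights -1, 2, 0, 0 for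
x, y, t, z the relation degenerates to z² + t³ + x²y = 0, and φ to a nontrivial ψ fixing the
components of φ-invariants (`Degeneration.exists_isExponentialMap`). By the rigidity result
`RussellModel.expInvariants_eq_top_of_y_mem`, ψ cannot fix y. A leading form of positive degree is
divisible by y, so φ-invariants have degree at most 0; a nonzero one without part of degree 0 would
be divisible by x. Thus the φ-invariants embed in k[t, z] with image fixed by ψ. They contain two
algebraically independent elements, so ψ fixes t and z, hence x²y, hence y: a contradiction.

Rigidity: if a nontrivial map fixes y, it has an invariant outside k[y]. Degenerating with weights
3, 0, 2, 3 and then -1, 2, 0, 0 makes its leading form bihomogeneous of positive degree, so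
divisible by x, t, z or some x²y - ρt³ because k is algebraically closed. This factor is invariant
together with y. Two facts then force triviality: y is not a square in the fraction field, so y p² +
c q² is anisotropic (`RussellModel.mem_of_y_mul_sq_add_mem`); and an invariant α p² + t³ forces t to
be invariant when p and t generate (`IsExponentialMap.mem_of_cubic_relation`). Both hold in every
characteristic. -/

/-! ### Exponential maps, their degree and their invariants -/

/-- Taylor expansion turns the condition φ_S φ_U = φ_{S+U} into an identity of coefficients. Hasse
derivatives play the role of divided powers, so no characteristic is excluded. -/
theorem coeff_aeval_C_X_add_X {A : Type*} [CommRing A] (p : A[X]) (i : ℕ) :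
    (aeval (C X + X : A[X][X]) p).coeff i = hasseDeriv i p := by
  have h2 : aeval (C X + X : A[X][X]) p = taylor X (p.map C) := by
    rw [taylor_apply, comp, eval₂_map, aeval_def, add_comm]
    rfl
  have h3 : hasseDeriv i (p.map C) = (hasseDeriv i p).map C := by
    ext n : 1
    simp [hasseDeriv_coeff]
  rw [h2, taylor_coeff, h3, eval_map, eval₂_C_X]

section ExponentialMaps

variable {k A : Type*} [Field k] [CommRing A] [Algebra k A] {φ : A →ₐ[k] A[X]}

theorem mem_expInvariants_iff {a : A} : a ∈ expInvariants φ ↔ φ a = C a := Iff.rfl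

namespace IsExponentialMap

theorem mem_iff_natDegree (h : IsExponentialMap φ) {a : A} :
    a ∈ expInvariants φ ↔ (φ a).natDegree = 0 := by
  rw [mem_expInvariants_iff]
  constructor
  · intro e
    rw [e, natDegree_C]
  · intro e
    have h1 := eq_C_of_natDegree_eq_zero e
    have h2 := h.eval_zero a
    rw [h1, eval_C] at h2
    rw [h1, h2]

theorem coeff_zero (h : IsExponentialMap φ) (a : A) : (φ a).coeff 0 = a := by
  rw [coeff_zero_eq_eval_zero, h.eval_zero]

theorem map_coeff (h : IsExponentialMap φ) (a : A) (i : ℕ) :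
    φ ((φ a).coeff i) = hasseDeriv i (φ a) := by
  have h1 := congrArg (fun p => p.coeff i) (h.comp_eq a)
  simpa only [coeff_aeval_C_X_add_X, Polynomial.coeff_map, RingHom.coe_coe] using h1

/-- The source of the degree arguments: later coefficients of φ(a) have smaller degree, and the top
one is invariant. -/
theorem natDegree_map_coeff_le (h : IsExponentialMap φ) (a : A) (i : ℕ) :
    (φ ((φ a).coeff i)).natDegree ≤ (φ a).natDegree - i := by
  rw [h.map_coeff]
  exact natDegree_hasseDeriv_le _ _

theorem coeff_mem_of_natDegree_le (h : IsExponentialMap φ) {a : A} {n : ℕ}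
    (hn : (φ a).natDegree ≤ n) : (φ a).coeff n ∈ expInvariants φ := by
  rw [h.mem_iff_natDegree]
  have := h.natDegree_map_coeff_le a n
  omega

/-- Degrees add in a domain, and invariants are the elements of degree 0. -/
theorem mem_left_of_mul_mem [IsDomain A] (h : IsExponentialMap φ) {a b : A} (ha : a * b ≠ 0)
    (hab : a * b ∈ expInvariants φ) : a ∈ expInvariants φ := by
  have hinj : ∀ c : A, c ≠ 0 → φ c ≠ 0 := by
    intro c hc h0
    apply hc
    rw [← h.coeff_zero c, h0, Polynomial.coeff_zero]
  rw [h.mem_iff_natDegree] at *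
  rw [map_mul, natDegree_mul (hinj _ (left_ne_zero_of_mul ha))
    (hinj _ (right_ne_zero_of_mul ha))] at hab
  omega

theorem mem_of_dvd [IsDomain A] (h : IsExponentialMap φ) {a b : A} (hb : b ≠ 0)
    (hab : a ∣ b) (hbm : b ∈ expInvariants φ) : a ∈ expInvariants φ := by
  obtain ⟨c, rfl⟩ := hab
  exact h.mem_left_of_mul_mem hb hbm

theorem mem_of_pow_mem [IsDomain A] (h : IsExponentialMap φ) {a : A} {n : ℕ} (hn : n ≠ 0)
    (hab : a ^ n ∈ expInvariants φ) : a ∈ expInvariants φ := by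
  rw [h.mem_iff_natDegree] at *
  rw [map_pow, natDegree_pow] at hab
  simpa [hn] using hab

theorem apply_aeval (p : A) (f : (expInvariants φ)[X]) :
    φ (aeval p f) = (f.map (algebraMap (expInvariants φ) A)).comp (φ p) := by
  induction f using Polynomial.induction_on' with
  | add f g hf hg => simp [hf, hg]
  | monomial n c =>
    have hc : φ (c : A) = C (c : A) := c.2
    simp only [aeval_monomial, map_mul, map_pow, Polynomial.map_monomial, monomial_comp]
    rw [show algebraMap (expInvariants φ) A c = (c : A) from rfl, hc]

theorem natDegree_apply_aeval [IsDomain A] (p : A) (f : (expInvariants φ)[X]) :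
    (φ (aeval p f)).natDegree = f.natDegree * (φ p).natDegree := by
  rw [apply_aeval, natDegree_comp, natDegree_map_eq_of_injective Subtype.val_injective]

/-- Degrees multiply under substitution, so an element of positive degree is transcendental over the
invariants. -/
theorem aeval_eq_zero_iff [IsDomain A] (h : IsExponentialMap φ) {p : A}
    (hp : p ∉ expInvariants φ) (f : (expInvariants φ)[X]) : aeval p f = 0 ↔ f = 0 := by
  refine ⟨fun h0 => ?_, fun h0 => by rw [h0, map_zero]⟩
  have h1 := natDegree_apply_aeval p f
  rw [h.mem_iff_natDegree] at hp
  rw [h0, map_zero, natDegree_zero, eq_comm, Nat.mul_eq_zero] at h1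
  have h2 := eq_C_of_natDegree_eq_zero (h1.resolve_right hp)
  rw [h2, aeval_C] at h0
  have : f.coeff 0 = 0 := Subtype.ext h0
  rw [h2, this, C_0]

theorem mem_of_isAlgebraic [IsDomain A] (h : IsExponentialMap φ) {p : A}
    (hp : IsAlgebraic (expInvariants φ) p) : p ∈ expInvariants φ := by
  by_contra hn
  obtain ⟨f, hf, hf0⟩ := hp
  exact hf ((h.aeval_eq_zero_iff hn f).1 hf0)

end IsExponentialMap

/-- The elements whose image under `φ` has degree at most `n`, as a module over the invariants. -/
noncomputable def expDegreeLE (φ : A →ₐ[k] A[X]) (n : ℕ) : Submodule (expInvariants φ) A where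
  carrier := {a | (φ a).natDegree ≤ n}
  add_mem' {a b} ha hb := by
    simp only [Set.mem_ofPred_eq, map_add] at *
    exact (natDegree_add_le _ _).trans (max_le ha hb)
  zero_mem' := by simp
  smul_mem' c a ha := by
    have hc : φ (c : A) = C (c : A) := c.2
    simp only [Set.mem_ofPred_eq, Algebra.smul_def, map_mul] at *
    rw [show algebraMap (expInvariants φ) A c = (c : A) from rfl, hc]
    exact (natDegree_C_mul_le _ _).trans ha

theorem mem_expDegreeLE {n : ℕ} {a : A} : a ∈ expDegreeLE φ n ↔ (φ a).natDegree ≤ n := Iff.rfl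

/-- The coefficient of `U ^ n` as a linear map on the elements of degree at most `n`. -/
noncomputable def expLeadingCoeff (h : IsExponentialMap φ) (n : ℕ) :
    expDegreeLE φ n →ₗ[expInvariants φ] expInvariants φ where
  toFun a := ⟨(φ (a : A)).coeff n, h.coeff_mem_of_natDegree_le a.2⟩
  map_add' a b := by ext; simp
  map_smul' c a := by
    have hc : φ (c : A) = C (c : A) := c.2
    ext
    simp only [SetLike.val_smul, Algebra.smul_def, map_mul, RingHom.id_apply, MulMemClass.coe_mul]
    rw [show algebraMap (expInvariants φ) A c = (c : A) from rfl, hc, coeff_C_mul]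
    rfl

/-- The kernel of the top-coefficient map consists of elements of smaller degree and its image lies
in the invariants, so each degree adds at most 1 to the rank. -/
theorem rank_expDegreeLE_le [IsDomain A] (h : IsExponentialMap φ) (n : ℕ) :
    Module.rank (expInvariants φ) (expDegreeLE φ n) ≤ n + 1 := by
  have key : ∀ n, Module.rank (expInvariants φ) (expDegreeLE φ n) ≤
      1 + Module.rank (expInvariants φ) (LinearMap.ker (expLeadingCoeff h n)) := by
    intro n
    rw [← LinearMap.rank_range_add_rank_ker (expLeadingCoeff h n)]
    gcongr
    exact (Submodule.rank_le _).trans (Module.rank_self _).le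
  induction n with
  | zero =>
    refine (key 0).trans ?_
    have : LinearMap.ker (expLeadingCoeff h 0) = ⊥ := by
      rw [LinearMap.ker_eq_bot']
      rintro ⟨a, ha⟩ h0
      have h1 : (φ a).coeff 0 = 0 := congrArg Subtype.val h0
      rw [h.coeff_zero] at h1
      exact Subtype.ext h1
    rw [this]
    simp
  | succ n ih =>
    refine (key _).trans ?_
    have : Module.rank (expInvariants φ) (LinearMap.ker (expLeadingCoeff h (n + 1))) ≤
        Module.rank (expInvariants φ) (expDegreeLE φ n) := by
      let f : LinearMap.ker (expLeadingCoeff h (n + 1)) →ₗ[expInvariants φ] expDegreeLE φ n :=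
        LinearMap.codRestrict _ ((Submodule.subtype _).comp (Submodule.subtype _)) (by
          rintro ⟨⟨a, ha⟩, h0⟩
          have h1 : (φ a).coeff (n + 1) = 0 := congrArg Subtype.val h0
          rw [mem_expDegreeLE] at ha ⊢
          exact (natDegree_le_pred ha h1))
      refine LinearMap.rank_le_of_injective f ?_
      intro a b hab
      have := congrArg (fun c : expDegreeLE φ n => (c : A)) hab
      exact Subtype.ext (Subtype.ext this)
    calc _ ≤ 1 + ((n : Cardinal) + 1) := by gcongr; exact this.trans ih
      _ = _ := by push_cast; ring

/-- The m² monomials with exponents below m have degree at most mW, where the rank grows only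
linearly in m. -/
theorem not_algebraicIndependent_pair [IsDomain A] (h : IsExponentialMap φ) (v : Fin 2 → A) :
    ¬ AlgebraicIndependent (expInvariants φ) v := by
  intro hv
  have hli : LinearIndependent (expInvariants φ) (fun s : Fin 2 →₀ ℕ =>
      MvPolynomial.aeval v (MvPolynomial.monomial s (1 : expInvariants φ))) := by
    have := (MvPolynomial.basisMonomials (Fin 2) (expInvariants φ)).linearIndependent.map'
      (MvPolynomial.aeval v).toLinearMap (LinearMap.ker_eq_bot.2 hv)
    simpa [Function.comp_def] using this
  set W := (φ (v 0)).natDegree + (φ (v 1)).natDegree with hW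
  -- For this m, m² = 2mW + 2m exceeds the bound mW + 1.
  set m := 2 * W + 2 with hm
  let e : Fin m × Fin m → (Fin 2 →₀ ℕ) := fun p =>
    Finsupp.single 0 (p.1 : ℕ) + Finsupp.single 1 (p.2 : ℕ)
  have he : Function.Injective e := by
    rintro ⟨a, b⟩ ⟨c, d⟩ hab
    have h0 := DFunLike.congr_fun hab 0
    have h1 := DFunLike.congr_fun hab 1
    simp [e] at h0 h1
    exact Prod.ext (Fin.ext h0) (Fin.ext h1)
  have hli2 := hli.comp e he
  have hval : ∀ p, MvPolynomial.aeval v (MvPolynomial.monomial (e p) (1 : expInvariants φ)) =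
      v 0 ^ (p.1 : ℕ) * v 1 ^ (p.2 : ℕ) := by
    intro p
    rw [MvPolynomial.aeval_monomial, Finsupp.prod_fintype _ _ (by simp)]
    simp [e]
  have hmem : ∀ p : Fin m × Fin m, v 0 ^ (p.1 : ℕ) * v 1 ^ (p.2 : ℕ) ∈ expDegreeLE φ (m * W) := by
    rintro ⟨a, b⟩
    rw [mem_expDegreeLE, map_mul, map_pow, map_pow]
    refine natDegree_mul_le.trans ?_
    rw [natDegree_pow, natDegree_pow, hW, mul_add]
    exact add_le_add (Nat.mul_le_mul_right _ a.2.le) (Nat.mul_le_mul_right _ b.2.le)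
  have hli3 : LinearIndependent (expInvariants φ)
      (fun p : Fin m × Fin m => (⟨_, hmem p⟩ : expDegreeLE φ (m * W))) := by
    apply LinearIndependent.of_comp (Submodule.subtype _)
    convert hli2 using 1
    ext p
    exact (hval p).symm
  have hc := hli3.cardinal_lift_le_rank
  have hc2 := Cardinal.lift_le.2 (rank_expDegreeLE_le h (m * W))
  have hc3 := hc.trans hc2
  simp only [Cardinal.mk_fintype, Fintype.card_prod, Fintype.card_fin, Cardinal.lift_natCast,
    Cardinal.lift_add, Cardinal.lift_one] at hc3
  norm_cast at hc3
  have : m * m = m * W + m * W + 2 * m := by rw [hm]; ring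
  omega

theorem trdeg_expInvariants_le_one [IsDomain A] (h : IsExponentialMap φ) :
    Algebra.trdeg (expInvariants φ) A ≤ 1 := by
  refine ciSup_le' fun s => ?_
  rw [Cardinal.le_one_iff_subsingleton]
  refine ⟨fun a b => ?_⟩
  by_contra hab
  refine not_algebraicIndependent_pair h (fun i => ((![a, b] i : s.1) : A)) ?_
  refine AlgebraicIndependent.comp s.2 ![a, b] ?_
  intro i j hij
  fin_cases i <;> fin_cases j <;> simp_all [eq_comm]

theorem exists_algebraicIndependent_pair_of_one_lt_trdeg {R S : Type*} [CommRing R] [CommRing S]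
    [Algebra R S] (h : 1 < Algebra.trdeg R S) : ∃ v : Fin 2 → S, AlgebraicIndependent R v := by
  by_contra! hv
  refine h.not_ge (ciSup_le' fun s => ?_)
  rw [Cardinal.le_one_iff_subsingleton]
  refine ⟨fun a b => ?_⟩
  by_contra hab
  refine hv (fun i => ((![a, b] i : s.1) : S)) ?_
  refine AlgebraicIndependent.comp s.2 ![a, b] ?_
  intro i j hij
  fin_cases i <;> fin_cases j <;> simp_all [eq_comm]

theorem IsExponentialMap.exists_algebraicIndependent_pair [IsDomain A] (h : IsExponentialMap φ)
    (hA : 2 < Algebra.trdeg k A) :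
    ∃ v : Fin 2 → expInvariants φ, AlgebraicIndependent k v := by
  apply exists_algebraicIndependent_pair_of_one_lt_trdeg
  by_contra! hle
  have h1 := trdeg_add_eq k (expInvariants φ) (A := A)
  have h2 := add_le_add hle (trdeg_expInvariants_le_one h)
  rw [h1, one_add_one_eq_two] at h2
  exact hA.not_ge h2

theorem map_aeval_C_X_add_X {A B : Type*} [CommRing A] [CommRing B] (f : A →+* B) (p : A[X]) :
    (aeval (C X + X : A[X][X]) p).map (mapRingHom f) = aeval (C X + X : B[X][X]) (p.map f) := by
  induction p using Polynomial.induction_on' with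
  | add p q hp hq => simp only [map_add, Polynomial.map_add, hp, hq]
  | monomial n c => simp [aeval_monomial, algebraMap_eq, Polynomial.algebraMap_apply]

/-- Exponential maps can be transported along algebra isomorphisms. -/
theorem IsExponentialMap.conj {B : Type*} [CommRing B] [Algebra k B] (h : IsExponentialMap φ)
    (e : A ≃ₐ[k] B) :
    IsExponentialMap ((mapAlgHom (e : A →ₐ[k] B)).comp (φ.comp (e.symm : B →ₐ[k] A))) where
  eval_zero b := by
    have := h.coeff_zero (e.symm b)
    rw [← coeff_zero_eq_eval_zero]
    simp [this]
  comp_eq b := by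
    have h1 := congrArg (Polynomial.map (mapRingHom (e : A →+* B))) (h.comp_eq (e.symm b))
    rw [map_aeval_C_X_add_X, Polynomial.map_map] at h1
    refine Eq.trans ?_ h1
    simp only [AlgHom.comp_apply, coe_mapAlgHom, Polynomial.map_map]
    congr 1
    ext a : 1
    simp [mapAlgHom]

end ExponentialMaps

/-! ### Filtrations and associated graded rings -/

/-- A degeneration of a ring `A` to a ring `B`: an exhaustive and separated filtration `fil` of `A`
indexed by `ℚ`, together with additive maps `comp n` that send an element of `fil n` to its
component of degree `n` in `B`, the associated graded ring. -/
structure Degeneration (A B : Type*) [CommRing A] [CommRing B] where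
  fil : ℚ → AddSubgroup A
  comp : ℚ → A →+ B
  mono : ∀ {m n : ℚ}, m ≤ n → fil m ≤ fil n
  one_mem : (1 : A) ∈ fil 0
  comp_one : comp 0 1 = 1
  mul_mem : ∀ {m n : ℚ} {a b : A}, a ∈ fil m → b ∈ fil n → a * b ∈ fil (m + n)
  comp_mul : ∀ {m n : ℚ} {a b : A}, a ∈ fil m → b ∈ fil n →
    comp (m + n) (a * b) = comp m a * comp n b
  comp_eq_zero : ∀ {m n : ℚ} {a : A}, a ∈ fil m → m < n → comp n a = 0
  exists_lead : ∀ {a : A}, a ≠ 0 → ∃ n, a ∈ fil n ∧ comp n a ≠ 0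
  mem_closure : ∀ b : B, b ∈ AddSubgroup.closure {b | ∃ n, ∃ a ∈ fil n, comp n a = b}

namespace Degeneration

section Basic

variable {A B : Type*} [CommRing A] [CommRing B] (D : Degeneration A B)

theorem pow_mem {n : ℚ} {a : A} (ha : a ∈ D.fil n) (i : ℕ) : a ^ i ∈ D.fil (i * n) := by
  induction i with
  | zero => simpa using D.one_mem
  | succ i ih =>
    rw [pow_succ, show ((i + 1 : ℕ) : ℚ) * n = i * n + n by push_cast; ring]
    exact D.mul_mem ih ha

theorem comp_pow {n : ℚ} {a : A} (ha : a ∈ D.fil n) (i : ℕ) :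
    D.comp (i * n) (a ^ i) = D.comp n a ^ i := by
  induction i with
  | zero => simpa using D.comp_one
  | succ i ih =>
    rw [pow_succ, pow_succ, show ((i + 1 : ℕ) : ℚ) * n = i * n + n by push_cast; ring,
      D.comp_mul (D.pow_mem ha i) ha, ih]

/-- The trivial degeneration of a ring to itself, concentrated in degree `0`. -/
noncomputable def trivial (k : Type*) [CommRing k] : Degeneration k k where
  fil n := if 0 ≤ n then ⊤ else ⊥
  comp n := if n = 0 then AddMonoidHom.id k else 0
  mono {m n} h := by
    split_ifs with h1 h2
    · exact le_rfl
    · exact absurd (h1.trans h) h2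
    · exact bot_le
    · exact le_rfl
  one_mem := by simp
  comp_one := by simp
  mul_mem {m n a b} ha hb := by
    by_cases hm : 0 ≤ m
    · by_cases hn : 0 ≤ n
      · simp [add_nonneg hm hn]
      · have : b = 0 := by simpa [hn] using hb
        rw [this, mul_zero]
        exact zero_mem _
    · have : a = 0 := by simpa [hm] using ha
      rw [this, zero_mul]
      exact zero_mem _
  comp_mul {m n a b} ha hb := by
    by_cases hm : 0 ≤ m
    · by_cases hn : 0 ≤ n
      · by_cases hm0 : m = 0
        · by_cases hn0 : n = 0
          · simp [hm0, hn0]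
          · simp [hm0, hn0]
        · have : m + n ≠ 0 := by
            have := lt_of_le_of_ne hm (Ne.symm hm0)
            positivity
          simp [hm0, this]
      · have : b = 0 := by simpa [hn] using hb
        simp [this]
    · have : a = 0 := by simpa [hm] using ha
      simp [this]
  comp_eq_zero {m n a} ha h := by
    by_cases hm : 0 ≤ m
    · simp [(hm.trans_lt h).ne']
    · have : a = 0 := by simpa [hm] using ha
      simp [this]
  exists_lead {a} ha := ⟨0, by simp, by simpa using ha⟩
  mem_closure b := AddSubgroup.subset_closure ⟨0, b, by simp, by simp⟩

/-- The component of degree `n` of a polynomial whose variable has weight `w`. -/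
noncomputable def polyComp (w n : ℚ) : A[X] →+ B[X] where
  toFun F := F.sum fun i a => monomial i (D.comp (n - i * w) a)
  map_zero' := by simp
  map_add' F G := sum_add_index _ _ _ (by simp) (by simp)

theorem coeff_polyComp (w n : ℚ) (F : A[X]) (i : ℕ) :
    (D.polyComp w n F).coeff i = D.comp (n - i * w) (F.coeff i) := by
  change (F.sum fun i a => monomial i (D.comp (n - i * w) a)).coeff i = _
  rw [sum_def, finsetSum_coeff]
  simp only [coeff_monomial]
  rw [Finset.sum_ite_eq' F.support i fun b => D.comp (n - b * w) (F.coeff b)]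
  split_ifs with h
  · rfl
  · rw [notMem_support_iff.1 h, map_zero]

/-- The degeneration of a polynomial ring whose variable has weight `w`. -/
noncomputable def poly (w : ℚ) : Degeneration A[X] B[X] where
  fil n :=
    { carrier := {F | ∀ i : ℕ, F.coeff i ∈ D.fil (n - i * w)}
      add_mem' := fun ha hb i => by rw [coeff_add]; exact add_mem (ha i) (hb i)
      zero_mem' := fun i => by rw [coeff_zero]; exact zero_mem _
      neg_mem' := fun ha i => by rw [coeff_neg]; exact neg_mem (ha i) }
  comp n := D.polyComp w n
  mono h F hF i := D.mono (by linarith) (hF i)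
  one_mem i := by
    rw [coeff_one]
    split_ifs with h
    · simpa [h] using D.one_mem
    · exact zero_mem _
  comp_one := by
    ext i
    rw [coeff_polyComp, coeff_one, coeff_one]
    split_ifs with h
    · simpa [h] using D.comp_one
    · exact map_zero _
  mul_mem {m n F G} hF hG i := by
    rw [coeff_mul]
    refine sum_mem fun p hp => ?_
    rw [Finset.HasAntidiagonal.mem_antidiagonal] at hp
    have := D.mul_mem (hF p.1) (hG p.2)
    rwa [show m - p.1 * w + (n - p.2 * w) = m + n - i * w by rw [← hp]; push_cast; ring] at this
  comp_mul {m n F G} hF hG := by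
    ext i
    rw [coeff_polyComp, coeff_mul, coeff_mul, map_sum]
    refine Finset.sum_congr rfl fun p hp => ?_
    rw [Finset.HasAntidiagonal.mem_antidiagonal] at hp
    rw [coeff_polyComp, coeff_polyComp, ← D.comp_mul (hF p.1) (hG p.2), ← hp]
    congr 2
    push_cast
    ring
  comp_eq_zero {m n F} hF h := by
    ext i
    rw [coeff_polyComp, D.comp_eq_zero (hF i) (by linarith), coeff_zero]
  exists_lead {F} hF := by
    have h1 : ∀ i ∈ F.support, ∃ n, F.coeff i ∈ D.fil n ∧ D.comp n (F.coeff i) ≠ 0 :=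
      fun i hi => D.exists_lead (mem_support_iff.1 hi)
    choose! d hd using h1
    -- The degree of F is the largest degree of its terms; distinct powers of the variable cannot
    -- cancel.
    obtain ⟨j, hj, hmax⟩ := F.support.exists_max_image (fun i => d i + i * w)
      (support_nonempty.2 hF)
    refine ⟨d j + j * w, fun i => ?_, fun h0 => ?_⟩
    · by_cases hi : i ∈ F.support
      · exact D.mono (by have := hmax i hi; linarith) (hd i hi).1
      · rw [notMem_support_iff.1 hi]
        exact zero_mem _
    · have := congrArg (fun p => p.coeff j) h0
      simp only [coeff_polyComp, add_sub_cancel_right, coeff_zero] at this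
      exact (hd j hj).2 this
  mem_closure b := by
    induction b using Polynomial.induction_on' with
    | add p q hp hq => exact add_mem hp hq
    | monomial i b =>
      induction D.mem_closure b using AddSubgroup.closure_induction with
      | mem b hb =>
        obtain ⟨n, a, ha, rfl⟩ := hb
        refine AddSubgroup.subset_closure ⟨n + i * w, monomial i a, fun j => ?_, ?_⟩
        · rw [coeff_monomial]
          split_ifs with h
          · simpa [← h] using ha
          · exact zero_mem _
        · ext j
          rw [coeff_polyComp, coeff_monomial, coeff_monomial]
          split_ifs with h
          · simp [← h]
          · exact map_zero _
      | zero => rw [monomial_zero_right]; exact zero_mem _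
      | add p q _ _ hp hq => rw [map_add]; exact add_mem hp hq
      | neg p _ hp => rw [map_neg]; exact neg_mem hp

theorem mem_poly_fil {w n : ℚ} {F : A[X]} :
    F ∈ (D.poly w).fil n ↔ ∀ i : ℕ, F.coeff i ∈ D.fil (n - i * w) := Iff.rfl

theorem coeff_poly_comp (w n : ℚ) (F : A[X]) (i : ℕ) :
    ((D.poly w).comp n F).coeff i = D.comp (n - i * w) (F.coeff i) := D.coeff_polyComp w n F i

theorem C_mem_poly_fil {w n : ℚ} {a : A} (ha : a ∈ D.fil n) : C a ∈ (D.poly w).fil n := by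
  intro i
  rw [coeff_C]
  split_ifs with h
  · simpa [h] using ha
  · exact zero_mem _

theorem poly_comp_C (w n : ℚ) (a : A) : (D.poly w).comp n (C a) = C (D.comp n a) := by
  ext i
  rw [coeff_poly_comp, coeff_C, coeff_C]
  split_ifs with h
  · simp [h]
  · exact map_zero _

theorem X_mem_poly_fil (w : ℚ) : (X : A[X]) ∈ (D.poly w).fil w := by
  intro i
  rw [coeff_X]
  split_ifs with h
  · simpa [← h] using D.one_mem
  · exact zero_mem _

theorem poly_comp_X (w : ℚ) : (D.poly w).comp w (X : A[X]) = X := by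
  ext i
  rw [coeff_poly_comp, coeff_X, coeff_X]
  split_ifs with h
  · simpa [← h] using D.comp_one
  · exact map_zero _

open QuadraticAlgebra in
/-- The degeneration of the extension obtained by adjoining a square root `ω` of `c`, where `ω` has
weight `w`, to the extension obtained by adjoining a square root of the component of `c`. -/
noncomputable def quad (w : ℚ) {c : A} {c' : B} (hc : c ∈ D.fil (w + w))
    (hc' : D.comp (w + w) c = c') :
    Degeneration (QuadraticAlgebra A c 0) (QuadraticAlgebra B c' 0) where
  fil n :=
    { carrier := {a | a.re ∈ D.fil n ∧ a.im ∈ D.fil (n - w)}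
      add_mem' := fun ha hb => ⟨add_mem ha.1 hb.1, add_mem ha.2 hb.2⟩
      zero_mem' := ⟨zero_mem _, zero_mem _⟩
      neg_mem' := fun ha => ⟨neg_mem ha.1, neg_mem ha.2⟩ }
  comp n :=
    { toFun := fun a => ⟨D.comp n a.re, D.comp (n - w) a.im⟩
      map_zero' := by ext <;> simp
      map_add' := fun a b => by ext <;> simp }
  mono h a ha := ⟨D.mono h ha.1, D.mono (by linarith) ha.2⟩
  one_mem := ⟨D.one_mem, zero_mem _⟩
  comp_one := by ext <;> simp [D.comp_one]
  mul_mem {m n a b} ha hb := by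
    refine ⟨?_, ?_⟩
    · rw [re_mul]
      refine add_mem (D.mul_mem ha.1 hb.1) ?_
      have := D.mul_mem (D.mul_mem hc ha.2) hb.2
      rwa [show w + w + (m - w) + (n - w) = m + n by ring] at this
    · rw [im_mul, zero_mul, zero_mul, add_zero]
      have h1 := D.mul_mem ha.1 hb.2
      have h2 := D.mul_mem ha.2 hb.1
      rw [show m + (n - w) = m + n - w by ring] at h1
      rw [show m - w + n = m + n - w by ring] at h2
      exact add_mem h1 h2
  comp_mul {m n a b} ha hb := by
    have h0 := D.comp_mul ha.1 hb.1
    have h1 := D.comp_mul ha.1 hb.2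
    have h2 := D.comp_mul ha.2 hb.1
    have h3 := D.comp_mul (D.mul_mem hc ha.2) hb.2
    rw [D.comp_mul hc ha.2, hc', show w + w + (m - w) + (n - w) = m + n by ring] at h3
    rw [show m + (n - w) = m + n - w by ring] at h1
    rw [show m - w + n = m + n - w by ring] at h2
    ext
    · simp [h0, h3]
    · simp [h1, h2]
  comp_eq_zero {m n a} ha h := by
    ext
    · exact D.comp_eq_zero ha.1 h
    · exact D.comp_eq_zero ha.2 (by linarith)
  exists_lead {a} ha := by
    by_cases h1 : a.re = 0
    · have h2 : a.im ≠ 0 := fun h2 => ha (QuadraticAlgebra.ext h1 h2)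
      obtain ⟨n, hn, hn0⟩ := D.exists_lead h2
      refine ⟨n + w, ⟨by rw [h1]; exact zero_mem _, by simpa using hn⟩, fun h => hn0 ?_⟩
      simpa using congrArg QuadraticAlgebra.im h
    · obtain ⟨m, hm, hm0⟩ := D.exists_lead h1
      by_cases h2 : a.im = 0
      · exact ⟨m, ⟨hm, by rw [h2]; exact zero_mem _⟩,
          fun h => hm0 (congrArg QuadraticAlgebra.re h)⟩
      · obtain ⟨n, hn, hn0⟩ := D.exists_lead h2
        rcases le_total (n + w) m with hle | hle
        · exact ⟨m, ⟨hm, D.mono (by linarith) hn⟩, fun h => hm0 (congrArg QuadraticAlgebra.re h)⟩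
        · refine ⟨n + w, ⟨D.mono hle hm, by simpa using hn⟩, fun h => hn0 ?_⟩
          simpa using congrArg QuadraticAlgebra.im h
  mem_closure b := by
    obtain ⟨p, q⟩ := b
    have hp : (⟨p, 0⟩ : QuadraticAlgebra B c' 0) ∈ AddSubgroup.closure {b | ∃ n,
        ∃ a ∈ {a : QuadraticAlgebra A c 0 | a.re ∈ D.fil n ∧ a.im ∈ D.fil (n - w)},
          (⟨D.comp n a.re, D.comp (n - w) a.im⟩ : QuadraticAlgebra B c' 0) = b} := by
      induction D.mem_closure p using AddSubgroup.closure_induction with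
      | mem b hb =>
        obtain ⟨n, a, ha, rfl⟩ := hb
        exact AddSubgroup.subset_closure ⟨n, ⟨a, 0⟩, ⟨ha, zero_mem _⟩, by simp⟩
      | zero => exact zero_mem _
      | add p q _ _ hp hq =>
        rw [show (⟨p + q, 0⟩ : QuadraticAlgebra B c' 0) = ⟨p, 0⟩ + ⟨q, 0⟩ by ext <;> simp]
        exact add_mem hp hq
      | neg p _ hp => simpa using neg_mem hp
    have hq : (⟨0, q⟩ : QuadraticAlgebra B c' 0) ∈ AddSubgroup.closure {b | ∃ n,
        ∃ a ∈ {a : QuadraticAlgebra A c 0 | a.re ∈ D.fil n ∧ a.im ∈ D.fil (n - w)},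
          (⟨D.comp n a.re, D.comp (n - w) a.im⟩ : QuadraticAlgebra B c' 0) = b} := by
      induction D.mem_closure q using AddSubgroup.closure_induction with
      | mem b hb =>
        obtain ⟨n, a, ha, rfl⟩ := hb
        exact AddSubgroup.subset_closure
          ⟨n + w, ⟨0, a⟩, ⟨zero_mem _, by simpa using ha⟩, by simp⟩
      | zero => exact zero_mem _
      | add p q _ _ hp hq =>
        rw [show (⟨0, p + q⟩ : QuadraticAlgebra B c' 0) = ⟨0, p⟩ + ⟨0, q⟩ by ext <;> simp]
        exact add_mem hp hq
      | neg p _ hp => simpa using neg_mem hp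
    rw [show (⟨p, q⟩ : QuadraticAlgebra B c' 0) = ⟨p, 0⟩ + ⟨0, q⟩ by ext <;> simp]
    exact add_mem hp hq

end Basic

end Degeneration

/-! ### Induced maps and degeneration of exponential maps -/

namespace Degeneration

section AssociatedMaps

variable {A B : Type*} [CommRing A] [CommRing B] (D : Degeneration A B)

/-- A ring homomorphism that respects the filtrations. -/
def IsFiltered {A' B' : Type*} [CommRing A'] [CommRing B'] (D' : Degeneration A' B')
    (φ : A →+* A') : Prop :=
  ∀ n, ∀ a ∈ D.fil n, φ a ∈ D'.fil n

/-- Filtered ring homomorphisms from `A` induce ring homomorphisms from `B`. -/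
def HasAssociatedMaps.{v} : Prop :=
  ∀ {A' B' : Type v} [CommRing A'] [CommRing B'] (D' : Degeneration A' B') (φ : A →+* A'),
    D.IsFiltered D' φ → ∃ ψ : B →+* B', ∀ n, ∀ a ∈ D.fil n, ψ (D.comp n a) = D'.comp n (φ a)

theorem mem_trivial_fil {k : Type*} [CommRing k] {n : ℚ} {a : k} :
    a ∈ (trivial k).fil n ↔ (a ≠ 0 → 0 ≤ n) := by
  simp only [trivial]
  split_ifs with h
  · simp [h]
  · simp [h]

theorem trivial_comp_apply {k : Type*} [CommRing k] (n : ℚ) (a : k) :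
    (trivial k).comp n a = if n = 0 then a else 0 := by
  simp only [trivial]
  split_ifs with h <;> simp

theorem hasAssociatedMaps_trivial.{u, v} (k : Type u) [CommRing k] :
    (trivial k).HasAssociatedMaps.{u, u, v} := by
  intro A' B' _ _ D' φ hφ
  have hmem : ∀ a : k, φ a ∈ D'.fil 0 := fun a => hφ 0 a (mem_trivial_fil.2 fun _ => le_rfl)
  let ψ : k →+* B' :=
    { toFun := fun a => D'.comp 0 (φ a)
      map_one' := by rw [map_one, D'.comp_one]
      map_zero' := by rw [map_zero, map_zero]
      map_mul' := fun a b => by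
        have := D'.comp_mul (hmem a) (hmem b)
        rwa [add_zero, ← map_mul] at this
      map_add' := fun a b => by rw [map_add, map_add] }
  refine ⟨ψ, fun n a ha => ?_⟩
  change D'.comp 0 (φ ((trivial k).comp n a)) = _
  rw [trivial_comp_apply]
  split_ifs with h
  · rw [h]
  · rw [map_zero, map_zero]
    by_cases ha0 : a = 0
    · rw [ha0, map_zero, map_zero]
    · have := mem_trivial_fil.1 ha ha0
      exact (D'.comp_eq_zero (hmem a) (lt_of_le_of_ne this (Ne.symm h))).symm

variable {D}

theorem isFiltered_trivial {k A' B' : Type*} [CommRing k] [CommRing A'] [CommRing B']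
    (D' : Degeneration A' B') (φ : k →+* A') (h : ∀ c, φ c ∈ D'.fil 0) :
    (trivial k).IsFiltered D' φ := by
  intro n a ha
  by_cases ha0 : a = 0
  · rw [ha0, map_zero]
    exact zero_mem _
  · exact D'.mono (mem_trivial_fil.1 ha ha0) (h a)

theorem isFiltered_poly {A' B' : Type*} [CommRing A'] [CommRing B']
    {D' : Degeneration A' B'} {φ : A[X] →+* A'} {w : ℚ}
    (h : D.IsFiltered D' (φ.comp C)) (hX : φ X ∈ D'.fil w) : (D.poly w).IsFiltered D' φ := by
  intro n F hF
  rw [F.as_sum_support_C_mul_X_pow, map_sum]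
  refine sum_mem fun i _ => ?_
  rw [map_mul, map_pow]
  have := D'.mul_mem (h _ _ (hF i)) (D'.pow_mem hX i)
  rwa [sub_add_cancel] at this

theorem isFiltered_quad {A' B' : Type*} [CommRing A'] [CommRing B']
    {D' : Degeneration A' B'} {w : ℚ} {c : A} {c' : B} (hc : c ∈ D.fil (w + w))
    (hc' : D.comp (w + w) c = c') {φ : QuadraticAlgebra A c 0 →+* A'}
    (h : D.IsFiltered D' (φ.comp (algebraMap A _)))
    (hω : φ QuadraticAlgebra.omega ∈ D'.fil w) : (D.quad w hc hc').IsFiltered D' φ := by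
  intro n a ha
  rw [← QuadraticAlgebra.mk_eta a, QuadraticAlgebra.mk_eq_add_smul_omega, map_add,
    Algebra.smul_def, map_mul]
  refine add_mem (h _ _ ha.1) ?_
  have := D'.mul_mem (h _ _ ha.2) hω
  rwa [sub_add_cancel] at this

/-- The map induced on the base extends by sending the variable to the component of degree `w` of `φ
X`. -/
theorem HasAssociatedMaps.poly.{u₁, u₂, v} {A : Type u₁} {B : Type u₂} [CommRing A] [CommRing B]
    {D : Degeneration A B} (h : D.HasAssociatedMaps.{u₁, u₂, v}) (w : ℚ) :
    (D.poly w).HasAssociatedMaps.{u₁, u₂, v} := by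
  intro A' B' _ _ D' φ hφ
  obtain ⟨ψ, hψ⟩ := h D' (φ.comp C) fun n a ha => hφ n _ (D.C_mem_poly_fil ha)
  have hX : φ X ∈ D'.fil w := hφ w X (D.X_mem_poly_fil w)
  refine ⟨eval₂RingHom ψ (D'.comp w (φ X)), fun n F hF => ?_⟩
  have h1 : ((D.poly w).comp n F).natDegree ≤ F.natDegree := by
    rw [natDegree_le_iff_coeff_eq_zero]
    intro i hi
    rw [coeff_poly_comp, coeff_eq_zero_of_natDegree_lt hi, map_zero]
  rw [coe_eval₂RingHom, eval₂_eq_sum_range' _ (Nat.lt_succ_of_le h1)]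
  conv_rhs => rw [F.as_sum_range_C_mul_X_pow, map_sum, map_sum]
  refine Finset.sum_congr rfl fun i _ => ?_
  have h2 : φ (C (F.coeff i)) ∈ D'.fil (n - i * w) := hφ _ _ (D.C_mem_poly_fil (hF i))
  have h3 := D'.comp_mul h2 (D'.pow_mem hX i)
  rw [sub_add_cancel, D'.comp_pow hX] at h3
  rw [map_mul, map_pow, h3, coeff_poly_comp, hψ _ _ (hF i)]
  rfl

theorem HasAssociatedMaps.quad.{u₁, u₂, v} {A : Type u₁} {B : Type u₂} [CommRing A] [CommRing B]
    {D : Degeneration A B} (h : D.HasAssociatedMaps.{u₁, u₂, v}) {w : ℚ} {c : A} {c' : B}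
    (hc : c ∈ D.fil (w + w)) (hc' : D.comp (w + w) c = c') :
    (D.quad w hc hc').HasAssociatedMaps.{u₁, u₂, v} := by
  intro A' B' _ _ D' φ hφ
  have hmem : ∀ n, ∀ a ∈ D.fil n, φ (algebraMap A _ a) ∈ D'.fil n :=
    fun n a ha => hφ n _ ⟨ha, zero_mem _⟩
  obtain ⟨ψ, hψ⟩ := h D' (φ.comp (algebraMap A _)) hmem
  have hω : φ QuadraticAlgebra.omega ∈ D'.fil w := hφ w _ ⟨zero_mem _, by simpa using D.one_mem⟩
  -- The component of φ(ω) is a square root of the image of `c'`, which is what the quadratic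
  -- extension requires of the image of its generator.
  have hsq : D'.comp w (φ QuadraticAlgebra.omega) * D'.comp w (φ QuadraticAlgebra.omega) =
      ψ c' := by
    rw [← D'.comp_mul hω hω, ← map_mul, QuadraticAlgebra.omega_mul_omega_eq_add, ← hc', hψ _ _ hc]
    simp [Algebra.smul_def]
  let _ := ψ.toAlgebra
  let χ : QuadraticAlgebra B c' 0 →ₐ[B] B' := QuadraticAlgebra.lift
    ⟨D'.comp w (φ QuadraticAlgebra.omega), by
      rw [hsq, zero_smul, add_zero, Algebra.smul_def, mul_one]; rfl⟩
  refine ⟨χ, fun n a ha => ?_⟩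
  have h1 : χ ((D.quad w hc hc').comp n a) =
      ψ (D.comp n a.re) + ψ (D.comp (n - w) a.im) * D'.comp w (φ QuadraticAlgebra.omega) := by
    change χ ⟨D.comp n a.re, D.comp (n - w) a.im⟩ = _
    rw [QuadraticAlgebra.mk_eq_add_smul_omega, map_add, Algebra.smul_def, map_mul, AlgHom.commutes,
      AlgHom.commutes]
    simp only [χ, RingHom.algebraMap_toAlgebra]
    congr 2
    simp [QuadraticAlgebra.lift]
  have h2 := D'.comp_mul (hmem _ _ ha.2) hω
  rw [sub_add_cancel] at h2
  rw [RingHom.coe_coe, h1, hψ _ _ ha.1, hψ _ _ ha.2, RingHom.comp_apply, RingHom.comp_apply, ← h2]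
  conv_rhs => rw [← QuadraticAlgebra.mk_eta a, QuadraticAlgebra.mk_eq_add_smul_omega, map_add,
    map_add, Algebra.smul_def, map_mul]

end AssociatedMaps

/-- A nontrivial exponential map on `A` degenerates to a nontrivial exponential map on `B`, whose
invariants contain the components of the invariants on `A`. -/
theorem exists_isExponentialMap.{u} {k A B : Type u} [Field k] [CommRing A] [CommRing B]
    [Algebra k A] [Algebra k B] {D : Degeneration A B} (hD : D.HasAssociatedMaps.{u, u, u})
    (hk : ∀ c : k, algebraMap k A c ∈ D.fil 0)
    (hk' : ∀ c : k, D.comp 0 (algebraMap k A c) = algebraMap k B c)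
    {ι : Type*} [Finite ι] {g : ι → A} {w : ι → ℚ} (hg : ∀ i, g i ∈ D.fil (w i))
    (hgen : Algebra.adjoin k (Set.range g) = ⊤)
    (hfil : ∀ (D' : Degeneration A[X] B[X]) (φ : A →+* A[X]),
      (∀ c, φ (algebraMap k A c) ∈ D'.fil 0) → (∀ i, φ (g i) ∈ D'.fil (w i)) → D.IsFiltered D' φ)
    {φ : A →ₐ[k] A[X]} (h : IsExponentialMap φ) (hφ : expInvariants φ ≠ ⊤) :
    ∃ ψ : B →ₐ[k] B[X], IsExponentialMap ψ ∧ expInvariants ψ ≠ ⊤ ∧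
      ∀ n, ∀ a ∈ D.fil n, a ∈ expInvariants φ → D.comp n a ∈ expInvariants ψ := by
  cases nonempty_fintype ι
  have h0 : ∃ i, ∃ j, 0 < j ∧ (φ (g i)).coeff j ≠ 0 := by
    by_contra! hall
    apply hφ
    rw [eq_top_iff, ← hgen, Algebra.adjoin_le_iff]
    rintro _ ⟨i, rfl⟩
    rw [SetLike.mem_coe, h.mem_iff_natDegree, ← Nat.le_zero,
      natDegree_le_iff_coeff_eq_zero]
    exact fun j hj => hall i j hj
  have hlead : ∀ i j, ∃ d : ℚ, (φ (g i)).coeff j ≠ 0 →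
      ((φ (g i)).coeff j ∈ D.fil d ∧ D.comp d ((φ (g i)).coeff j) ≠ 0) := by
    intro i j
    by_cases hij : (φ (g i)).coeff j = 0
    · exact ⟨0, fun h => absurd hij h⟩
    · obtain ⟨d, hd⟩ := D.exists_lead hij
      exact ⟨d, fun _ => hd⟩
  choose d hd using hlead
  classical
  let s : Finset ((_ : ι) × ℕ) :=
    Finset.univ.sigma fun i => (φ (g i)).support.filter fun j => 0 < j
  have hs : ∀ i j, (⟨i, j⟩ : (_ : ι) × ℕ) ∈ s ↔ 0 < j ∧ (φ (g i)).coeff j ≠ 0 := by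
    intro i j
    simp [s, and_comm]
  obtain ⟨i₀, j₀, hij⟩ := h0
  -- U receives weight -r, with r the largest slope: the least r for which φ respects the
  -- filtrations on positive powers of U. Slopes may be fractional, hence filtrations indexed by ℚ.
  obtain ⟨⟨i, j⟩, hmem, hmax⟩ := s.exists_max_image (fun p => (d p.1 p.2 - w p.1) / (p.2 : ℚ))
    ⟨⟨i₀, j₀⟩, (hs _ _).2 hij⟩
  set r := (d i j - w i) / (j : ℚ) with hr
  rw [hs] at hmem
  have hj : (0 : ℚ) < j := by exact_mod_cast hmem.1
  have hfilφ : D.IsFiltered (D.poly (-r)) (φ : A →+* A[X]) := by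
    refine hfil _ _ (fun c => ?_) (fun l m => ?_)
    · rw [RingHom.coe_coe, AlgHom.commutes]
      exact D.C_mem_poly_fil (hk c)
    · rw [RingHom.coe_coe]
      rcases Nat.eq_zero_or_pos m with rfl | hm
      · rw [h.coeff_zero]
        simpa using hg l
      · by_cases hlm : (φ (g l)).coeff m = 0
        · rw [hlm]
          exact zero_mem _
        · refine D.mono ?_ (hd l m hlm).1
          have h1 := hmax _ ((hs l m).2 ⟨hm, hlm⟩)
          have hm' : (0 : ℚ) < m := by exact_mod_cast hm
          rw [div_le_iff₀ hm'] at h1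
          linarith
  have hfilφ' : ∀ n, ∀ a ∈ D.fil n, φ a ∈ (D.poly (-r)).fil n := hfilφ
  obtain ⟨ψ, hψ⟩ := hD (D.poly (-r)) _ hfilφ
  -- Components generate B additively, so identities need checking only on them.
  have hind : ∀ p : B → Prop, p 0 → (∀ a b, p a → p b → p (a + b)) → (∀ a, p a → p (-a)) →
      (∀ n, ∀ a ∈ D.fil n, p (D.comp n a)) → ∀ b, p b := by
    intro p hp0 hadd hneg hp b
    induction D.mem_closure b using AddSubgroup.closure_induction with
    | mem b hb =>
      obtain ⟨n, a, ha, rfl⟩ := hb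
      exact hp n a ha
    | zero => exact hp0
    | add a b _ _ ha hb => exact hadd a b ha hb
    | neg a _ ha => exact hneg a ha
  let ψ' : B →ₐ[k] B[X] :=
    { ψ with
      commutes' := fun c => by
        change ψ (algebraMap k B c) = _
        rw [← hk', hψ 0 _ (hk c), RingHom.coe_coe, AlgHom.commutes, Polynomial.algebraMap_apply,
          D.poly_comp_C, hk']
        rfl }
  have hψ' : ∀ n, ∀ a ∈ D.fil n, ψ' (D.comp n a) = (D.poly (-r)).comp n (φ a) := hψ
  refine ⟨ψ', ⟨fun b => ?_, fun b => ?_⟩, fun htop => ?_, fun n a ha hai => ?_⟩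
  · refine hind (fun b => (ψ' b).eval 0 = b) (by simp) (fun a b ha hb => ?_) (fun a ha => ?_)
      (fun n a ha => ?_) b
    · rw [map_add, eval_add, ha, hb]
    · rw [map_neg, eval_neg, ha]
    · rw [hψ' n a ha, ← coeff_zero_eq_eval_zero, D.coeff_poly_comp, h.coeff_zero]
      simp
  · refine hind (fun b => (ψ' b).map (ψ' : B →+* B[X]) = aeval (C X + X : B[X][X]) (ψ' b))
      (by simp) (fun a b ha hb => ?_) (fun a ha => ?_) (fun n a ha => ?_) b
    · simp only [map_add, Polynomial.map_add, ha, hb]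
    · simp only [map_neg, Polynomial.map_neg, ha]
    · ext l m
      rw [coeff_aeval_C_X_add_X, Polynomial.coeff_map, hψ' n a ha, D.coeff_poly_comp,
        RingHom.coe_coe, hψ' _ _ (hfilφ' n a ha l), h.map_coeff, D.coeff_poly_comp,
        hasseDeriv_coeff, hasseDeriv_coeff, D.coeff_poly_comp, ← nsmul_eq_mul (α := A), map_nsmul,
        nsmul_eq_mul]
      congr 3
      push_cast
      ring
  -- The maximal slope is attained at (i, j), so the U^j-coefficient of the image of the component
  -- of `g i` is a nonzero leading component.
  · have h1 : ψ' (D.comp (w i) (g i)) = C (D.comp (w i) (g i)) := by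
      rw [← mem_expInvariants_iff, htop]
      exact Algebra.mem_top
    have h2 := congrArg (fun p => p.coeff j) h1
    simp only [hψ' _ _ (hg i), D.coeff_poly_comp, coeff_C, hmem.1.ne', if_false] at h2
    refine (hd i j hmem.2).2 ?_
    rw [← h2]
    congr 2
    rw [hr]
    field_simp
    ring
  · rw [mem_expInvariants_iff] at hai ⊢
    rw [hψ' n a ha, hai, D.poly_comp_C]

end Degeneration

/-! ### A model of the ring with basis 1, z over k[x][y][t] -/

section Model

variable {k : Type*} [Field k]

noncomputable instance : CommRing k[X][X] := inferInstance
noncomputable instance : CommRing k[X][X][X] := inferInstance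

/-- The polynomial `-(t ^ 3 + x ^ 2 y + e x)` in `k[x][y][t]`. -/
noncomputable def russellSq (e : k) : k[X][X][X] :=
  -(X ^ 3 + (C (C X)) ^ 2 * C X + C (C (C e)) * C (C X))

/-- The ring `k[x, y, t, z] / (z ^ 2 + t ^ 3 + x ^ 2 y + e x)`, as the extension of `k[x][y][t]` by
a square root `z` of `-(t ^ 3 + x ^ 2 y + e x)`. -/
abbrev RussellModel (e : k) : Type _ := QuadraticAlgebra k[X][X][X] (russellSq e) 0

namespace RussellModel

variable {e : k}

/-- The inclusion of `k[x][y][t]`. -/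
noncomputable def ofPoly (e : k) : k[X][X][X] →ₐ[k] RussellModel e :=
  (Algebra.ofId k[X][X][X] (RussellModel e)).restrictScalars k

noncomputable def x (e : k) : RussellModel e := ofPoly e (C (C X))
noncomputable def y (e : k) : RussellModel e := ofPoly e (C X)
noncomputable def t (e : k) : RussellModel e := ofPoly e X
noncomputable def z (e : k) : RussellModel e := QuadraticAlgebra.omega

theorem ofPoly_apply (p : k[X][X][X]) : ofPoly e p = ⟨p, 0⟩ := rfl

theorem ofPoly_injective : Function.Injective (ofPoly e) := fun _ _ h =>
  congrArg QuadraticAlgebra.re h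

theorem eq_add_mul_z (a : RussellModel e) : a = ofPoly e a.re + ofPoly e a.im * z e := by
  conv_lhs => rw [← QuadraticAlgebra.mk_eta a, QuadraticAlgebra.mk_eq_add_smul_omega]
  rw [Algebra.smul_def]
  rfl

theorem z_mul_z_eq_ofPoly : z e * z e = ofPoly e (russellSq e) :=
  QuadraticAlgebra.omega_mul_omega_eq_mk

theorem z_mul_z : z e * z e = -(t e ^ 3 + x e ^ 2 * y e + algebraMap k _ e * x e) := by
  have h : z e * z e = ofPoly e (-(X ^ 3 + (C (C X)) ^ 2 * C X + C (C (C e)) * C (C X))) :=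
    z_mul_z_eq_ofPoly
  rw [h, map_neg, map_add, map_add, map_mul, map_mul, map_pow, map_pow]
  rfl

theorem mem_of_generators (S : Subalgebra k (RussellModel e)) (hx : x e ∈ S) (hy : y e ∈ S)
    (ht : t e ∈ S) (hz : z e ∈ S) (a : RussellModel e) : a ∈ S := by
  have h1 : ∀ p : k[X], ofPoly e (C (C p)) ∈ S := by
    intro p
    induction p using Polynomial.induction_on' with
    | add p q hp hq => simpa only [map_add] using add_mem hp hq
    | monomial n c =>
      rw [← C_mul_X_pow_eq_monomial, map_mul, map_mul, map_mul, map_pow, map_pow, map_pow]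
      exact mul_mem (S.algebraMap_mem c) (pow_mem hx n)
  have h2 : ∀ p : k[X][X], ofPoly e (C p) ∈ S := by
    intro p
    induction p using Polynomial.induction_on' with
    | add p q hp hq => simpa only [map_add] using add_mem hp hq
    | monomial n c =>
      rw [← C_mul_X_pow_eq_monomial, map_mul, map_mul, map_pow, map_pow]
      exact mul_mem (h1 c) (pow_mem hy n)
  have h3 : ∀ p : k[X][X][X], ofPoly e p ∈ S := by
    intro p
    induction p using Polynomial.induction_on' with
    | add p q hp hq => simpa only [map_add] using add_mem hp hq
    | monomial n c =>
      rw [← C_mul_X_pow_eq_monomial, map_mul, map_pow]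
      exact mul_mem (h2 c) (pow_mem ht n)
  rw [eq_add_mul_z a]
  exact add_mem (h3 _) (mul_mem (h3 _) hz)

theorem algHom_ext {R : Type*} [CommRing R] [Algebra k R] {f g : RussellModel e →ₐ[k] R}
    (hx : f (x e) = g (x e)) (hy : f (y e) = g (y e)) (ht : f (t e) = g (t e))
    (hz : f (z e) = g (z e)) : f = g :=
  AlgHom.ext fun a => mem_of_generators (AlgHom.equalizer f g) hx hy ht hz a

section Lift

variable {R : Type*} [CommRing R] [Algebra k R]

/-- Evaluation of polynomials in `k[x][y][t]`. -/
noncomputable def evalPoly (x y t : R) : k[X][X][X] →+* R :=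
  eval₂RingHom (eval₂RingHom ((aeval x : k[X] →ₐ[k] R) : k[X] →+* R) y) t

theorem evalPoly_X (x y t : R) : evalPoly x y t (X : k[X][X][X]) = t := by simp [evalPoly]
theorem evalPoly_C_X (x y t : R) : evalPoly x y t (C X : k[X][X][X]) = y := by simp [evalPoly]
theorem evalPoly_C_C_X (x y t : R) : evalPoly x y t (C (C X) : k[X][X][X]) = x := by
  simp [evalPoly]
theorem evalPoly_C_C_C (x y t : R) (c : k) :
    evalPoly x y t (C (C (C c)) : k[X][X][X]) = algebraMap k R c := by
  simp [evalPoly]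

theorem exists_lift (x' y' t' z' : R)
    (h : z' * z' = -(t' ^ 3 + x' ^ 2 * y' + algebraMap k R e * x')) :
    ∃ f : RussellModel e →ₐ[k] R, f (x e) = x' ∧ f (y e) = y' ∧ f (t e) = t' ∧ f (z e) = z' := by
  let _ : Algebra k[X][X][X] R := (evalPoly x' y' t').toAlgebra
  have htower : IsScalarTower k k[X][X][X] R :=
    IsScalarTower.of_algebraMap_eq fun c => (evalPoly_C_C_C x' y' t' c).symm
  let f : RussellModel e →ₐ[k[X][X][X]] R := QuadraticAlgebra.lift
    ⟨z', by
      rw [h, zero_smul, add_zero, Algebra.smul_def, mul_one, RingHom.algebraMap_toAlgebra,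
        russellSq, map_neg, map_add, map_add, map_mul, map_mul, map_pow, map_pow, evalPoly_X,
        evalPoly_C_X, evalPoly_C_C_X, evalPoly_C_C_C]⟩
  have hf : ∀ p, f (ofPoly e p) = evalPoly x' y' t' p := fun p => f.commutes p
  refine ⟨f.restrictScalars k, (hf _).trans (evalPoly_C_C_X _ _ _),
    (hf _).trans (evalPoly_C_X _ _ _), (hf _).trans (evalPoly_X _ _ _), ?_⟩
  change f QuadraticAlgebra.omega = z'
  simp [f, QuadraticAlgebra.lift]

end Lift

theorem natDegree_russellSq (e : k) : (russellSq e).natDegree = 3 := by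
  rw [russellSq, natDegree_neg, ← C_pow, ← C_mul, ← C_mul, add_assoc, ← C_add, natDegree_X_pow_add_C]

/-- For q ≠ 0 one side has even degree and the other odd degree. -/
theorem eq_zero_of_sq_eq_mul_sq {R : Type*} [CommRing R] [IsDomain R] {c p q : R[X]}
    (hc : Odd c.natDegree) (h : p ^ 2 = c * q ^ 2) : q = 0 := by
  by_contra hq
  have hc0 : c ≠ 0 := by
    rintro rfl
    simp at hc
  have h1 := congrArg natDegree h
  rw [natDegree_pow, natDegree_mul hc0 (pow_ne_zero 2 hq), natDegree_pow] at h1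
  obtain ⟨m, hm⟩ := hc
  omega

/-- Since z² has odd degree 3 in t, the norm form is anisotropic; being multiplicative, it shows
that the model is a domain. -/
theorem eq_zero_of_norm_eq_zero {a : RussellModel e} (h : QuadraticAlgebra.norm a = 0) : a = 0 := by
  rw [QuadraticAlgebra.norm_def] at h
  have h1 : a.re ^ 2 = russellSq e * a.im ^ 2 := by linear_combination h
  have h2 := eq_zero_of_sq_eq_mul_sq (by rw [natDegree_russellSq]; decide) h1
  refine QuadraticAlgebra.ext ?_ h2
  rw [h2] at h1
  simpa using h1

instance : IsDomain (RussellModel e) := by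
  have : NoZeroDivisors (RussellModel e) := by
    refine ⟨fun {a b} hab => ?_⟩
    have h := congrArg QuadraticAlgebra.norm hab
    rw [map_mul, QuadraticAlgebra.norm_zero, mul_eq_zero] at h
    exact h.imp eq_zero_of_norm_eq_zero eq_zero_of_norm_eq_zero
  exact NoZeroDivisors.to_isDomain _

theorem two_lt_trdeg : 2 < Algebra.trdeg k (RussellModel e) := by
  have h1 := trdeg_add_eq k k[X] (A := k[X][X])
  have h2 := trdeg_add_eq k k[X][X] (A := k[X][X][X])
  rw [Polynomial.trdeg_of_isDomain, Polynomial.trdeg_of_isDomain] at h1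
  rw [← h1, Polynomial.trdeg_of_isDomain] at h2
  have h3 := trdeg_le_of_injective (ofPoly e) ofPoly_injective
  rw [← h2] at h3
  refine lt_of_lt_of_le ?_ h3
  norm_cast

theorem ne_zero_of_ofPoly {p : k[X][X][X]} (hp : p ≠ 0) : ofPoly e p ≠ 0 := fun h =>
  hp (ofPoly_injective (h.trans (map_zero _).symm))

theorem x_ne_zero : x e ≠ 0 := ne_zero_of_ofPoly (by simp)
theorem y_ne_zero : y e ≠ 0 := ne_zero_of_ofPoly (by simp)

end RussellModel

end Model

/-! ### Identification with the model -/

/-- The Russell ring is isomorphic to its model. -/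
theorem exists_algEquiv_russellModel (k : Type*) [Field k] :
    ∃ f : RussellModel (1 : k) ≃ₐ[k] RussellRing k, f (RussellModel.x 1) = russellX k := by
  let π : MvPolynomial (Fin 4) k →ₐ[k] RussellRing k := Ideal.Quotient.mkₐ k _
  have hπ : π (russellPoly k) = 0 :=
    Ideal.Quotient.eq_zero_iff_mem.2 (Ideal.mem_span_singleton_self _)
  have hπ' := hπ
  simp only [russellPoly, map_add, map_mul, map_pow] at hπ'
  obtain ⟨f, hx, hy, ht, hz⟩ := RussellModel.exists_lift (e := (1 : k)) (π (MvPolynomial.X 0))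
    (π (MvPolynomial.X 1)) (π (MvPolynomial.X 3)) (π (MvPolynomial.X 2))
    (by rw [map_one, one_mul]; linear_combination hπ')
  let v : Fin 4 → RussellModel (1 : k) :=
    ![RussellModel.x 1, RussellModel.y 1, RussellModel.z 1, RussellModel.t 1]
  have hv : MvPolynomial.aeval v (russellPoly k) = 0 := by
    simp only [russellPoly, map_add, map_mul, map_pow, MvPolynomial.aeval_X, v]
    have := RussellModel.z_mul_z (e := (1 : k))
    rw [map_one, one_mul] at this
    simp only [Matrix.cons_val]
    linear_combination this
  let g : RussellRing k →ₐ[k] RussellModel (1 : k) :=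
    Ideal.Quotient.liftₐ _ (MvPolynomial.aeval v) fun a ha => by
      obtain ⟨b, rfl⟩ := Ideal.mem_span_singleton.1 ha
      rw [map_mul, hv, zero_mul]
  have hg : ∀ p, g (π p) = MvPolynomial.aeval v p := fun p => rfl
  have hsurj : Function.Surjective π := Ideal.Quotient.mk_surjective
  refine ⟨AlgEquiv.ofAlgHom f g ?_ ?_, hx⟩
  · ext r
    obtain ⟨p, rfl⟩ := hsurj r
    have : (f.comp g).comp π = π := by
      ext i
      simp only [AlgHom.comp_apply, hg, MvPolynomial.aeval_X]
      fin_cases i <;> simp [v, hx, hy, ht, hz]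
    exact DFunLike.congr_fun this p
  · refine RussellModel.algHom_ext ?_ ?_ ?_ ?_ <;>
      simp [hx, hy, ht, hz, hg, v]

/-! ### Weight degenerations of the model -/

/-- Weights of the variables `x, y, t, z` for which the leading form of
`z ^ 2 + t ^ 3 + x ^ 2 y + e x` is `z ^ 2 + t ^ 3 + x ^ 2 y`. -/
structure RussellWeight {k : Type*} [Field k] (e : k) where
  wx : ℚ
  wy : ℚ
  wt : ℚ
  wz : ℚ
  ht : 3 * wt = wz + wz
  hxy : 2 * wx + wy = wz + wz
  hx : e = 0 ∨ wx < wz + wz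

namespace RussellWeight

section Degen

variable {k : Type*} [Field k] {e : k} (W : RussellWeight e)

/-- The weight degeneration of `k[x][y][t]` to itself. -/
noncomputable def polyDegeneration : Degeneration k[X][X][X] k[X][X][X] :=
  (((Degeneration.trivial k).poly W.wx).poly W.wy).poly W.wt

theorem mem_polyDegeneration_fil {n : ℚ} {p : k[X][X][X]} : p ∈ W.polyDegeneration.fil n ↔
    ∀ b j i : ℕ, ((p.coeff b).coeff j).coeff i ≠ 0 → i * W.wx + j * W.wy + b * W.wt ≤ n := by
  simp only [polyDegeneration, Degeneration.mem_poly_fil, Degeneration.mem_trivial_fil]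
  refine forall_congr' fun b => forall_congr' fun j => forall_congr' fun i =>
    imp_congr_right fun _ => ?_
  constructor <;> intro <;> linarith

theorem coeff_polyDegeneration_comp (n : ℚ) (p : k[X][X][X]) (b j i : ℕ) :
    (((W.polyDegeneration.comp n p).coeff b).coeff j).coeff i =
      if i * W.wx + j * W.wy + b * W.wt = n then ((p.coeff b).coeff j).coeff i else 0 := by
  simp only [polyDegeneration, Degeneration.coeff_poly_comp, Degeneration.trivial_comp_apply]
  refine if_congr ?_ rfl rfl
  constructor <;> intro <;> linarith

theorem C_C_X_mem : (C (C X) : k[X][X][X]) ∈ W.polyDegeneration.fil W.wx :=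
  Degeneration.C_mem_poly_fil _ (Degeneration.C_mem_poly_fil _ (Degeneration.X_mem_poly_fil _ _))

theorem comp_C_C_X : W.polyDegeneration.comp W.wx (C (C X) : k[X][X][X]) = C (C X) := by
  rw [polyDegeneration, Degeneration.poly_comp_C, Degeneration.poly_comp_C,
    Degeneration.poly_comp_X]

theorem C_X_mem : (C X : k[X][X][X]) ∈ W.polyDegeneration.fil W.wy :=
  Degeneration.C_mem_poly_fil _ (Degeneration.X_mem_poly_fil _ _)

theorem comp_C_X : W.polyDegeneration.comp W.wy (C X : k[X][X][X]) = C X := by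
  rw [polyDegeneration, Degeneration.poly_comp_C, Degeneration.poly_comp_X]

theorem X_mem : (X : k[X][X][X]) ∈ W.polyDegeneration.fil W.wt :=
  Degeneration.X_mem_poly_fil _ _

theorem comp_X : W.polyDegeneration.comp W.wt (X : k[X][X][X]) = X :=
  Degeneration.poly_comp_X _ _

theorem C_C_C_mem (c : k) : (C (C (C c)) : k[X][X][X]) ∈ W.polyDegeneration.fil 0 :=
  Degeneration.C_mem_poly_fil _ (Degeneration.C_mem_poly_fil _
    (Degeneration.C_mem_poly_fil _ (Degeneration.mem_trivial_fil.2 fun _ => le_rfl)))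

theorem comp_C_C_C (c : k) :
    W.polyDegeneration.comp 0 (C (C (C c)) : k[X][X][X]) = C (C (C c)) := by
  rw [polyDegeneration, Degeneration.poly_comp_C, Degeneration.poly_comp_C,
    Degeneration.poly_comp_C, Degeneration.trivial_comp_apply, if_pos rfl]

/-- The terms t³ and x²y have weight exactly `2 * wz`; the term e x vanishes or has smaller weight
and is lost. -/
theorem russellSq_mem_and_comp : russellSq e ∈ W.polyDegeneration.fil (W.wz + W.wz) ∧
    W.polyDegeneration.comp (W.wz + W.wz) (russellSq e) = russellSq 0 := by
  have h1 := W.polyDegeneration.pow_mem W.X_mem 3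
  have h1' := W.polyDegeneration.comp_pow W.X_mem 3
  have h2 := W.polyDegeneration.pow_mem W.C_C_X_mem 2
  have h2' := W.polyDegeneration.comp_pow W.C_C_X_mem 2
  have h3 := W.polyDegeneration.mul_mem h2 W.C_X_mem
  have h3' := W.polyDegeneration.comp_mul h2 W.C_X_mem
  rw [h2', comp_C_C_X, comp_C_X] at h3'
  rw [comp_X] at h1'
  push_cast at h1 h1' h3 h3'
  rw [W.ht] at h1 h1'
  rw [W.hxy] at h3 h3'
  have h4 : C (C (C e)) * C (C X) ∈ W.polyDegeneration.fil (W.wz + W.wz) ∧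
      W.polyDegeneration.comp (W.wz + W.wz) (C (C (C e)) * C (C X)) = 0 := by
    rcases W.hx with rfl | hlt
    · simp only [map_zero, zero_mul]
      exact ⟨zero_mem _, trivial⟩
    · have h5 := W.polyDegeneration.mul_mem (W.C_C_C_mem e) W.C_C_X_mem
      rw [zero_add] at h5
      exact ⟨W.polyDegeneration.mono hlt.le h5, W.polyDegeneration.comp_eq_zero h5 hlt⟩
  refine ⟨neg_mem (add_mem (add_mem h1 h3) h4.1), ?_⟩
  rw [russellSq, russellSq, map_neg, map_add, map_add, h1', h3', h4.2]
  simp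

/-- The weight degeneration of the Russell model. -/
noncomputable def degeneration : Degeneration (RussellModel e) (RussellModel (0 : k)) :=
  W.polyDegeneration.quad W.wz W.russellSq_mem_and_comp.1 W.russellSq_mem_and_comp.2

theorem mem_degeneration_fil {n : ℚ} {a : RussellModel e} : a ∈ W.degeneration.fil n ↔
    a.re ∈ W.polyDegeneration.fil n ∧ a.im ∈ W.polyDegeneration.fil (n - W.wz) := Iff.rfl

theorem degeneration_comp (n : ℚ) (a : RussellModel e) : W.degeneration.comp n a =
    ⟨W.polyDegeneration.comp n a.re, W.polyDegeneration.comp (n - W.wz) a.im⟩ := rfl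

theorem ofPoly_mem {n : ℚ} {p : k[X][X][X]} (hp : p ∈ W.polyDegeneration.fil n) :
    RussellModel.ofPoly e p ∈ W.degeneration.fil n :=
  ⟨hp, zero_mem _⟩

theorem comp_ofPoly (n : ℚ) (p : k[X][X][X]) :
    W.degeneration.comp n (RussellModel.ofPoly e p) =
      RussellModel.ofPoly 0 (W.polyDegeneration.comp n p) := by
  rw [degeneration_comp, RussellModel.ofPoly_apply, RussellModel.ofPoly_apply, map_zero]

theorem x_mem : RussellModel.x e ∈ W.degeneration.fil W.wx := W.ofPoly_mem W.C_C_X_mem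
theorem y_mem : RussellModel.y e ∈ W.degeneration.fil W.wy := W.ofPoly_mem W.C_X_mem
theorem t_mem : RussellModel.t e ∈ W.degeneration.fil W.wt := W.ofPoly_mem W.X_mem
theorem z_mem : RussellModel.z e ∈ W.degeneration.fil W.wz :=
  ⟨zero_mem _, by rw [sub_self]; exact W.polyDegeneration.one_mem⟩

theorem comp_y : W.degeneration.comp W.wy (RussellModel.y e) = RussellModel.y 0 := by
  rw [RussellModel.y, comp_ofPoly, comp_C_X]
  rfl

end Degen

theorem hasAssociatedMaps.{u} {k : Type u} [Field k] {e : k} (W : RussellWeight e) :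
    W.degeneration.HasAssociatedMaps.{u, u, u} :=
  Degeneration.HasAssociatedMaps.quad (Degeneration.HasAssociatedMaps.poly
    (Degeneration.HasAssociatedMaps.poly (Degeneration.HasAssociatedMaps.poly
      (Degeneration.hasAssociatedMaps_trivial k) W.wx) W.wy) W.wt)
    W.russellSq_mem_and_comp.1 W.russellSq_mem_and_comp.2

theorem isFiltered_degeneration {k : Type*} [Field k] {e : k} (W : RussellWeight e)
    {A B : Type*} [CommRing A] [CommRing B] (D' : Degeneration A B) (φ : RussellModel e →+* A)
    (hc : ∀ c : k, φ (algebraMap k _ c) ∈ D'.fil 0) (hx : φ (RussellModel.x e) ∈ D'.fil W.wx)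
    (hy : φ (RussellModel.y e) ∈ D'.fil W.wy) (ht : φ (RussellModel.t e) ∈ D'.fil W.wt)
    (hz : φ (RussellModel.z e) ∈ D'.fil W.wz) : W.degeneration.IsFiltered D' φ := by
  refine Degeneration.isFiltered_quad _ _ ?_ hz
  refine Degeneration.isFiltered_poly ?_ ht
  refine Degeneration.isFiltered_poly ?_ hy
  refine Degeneration.isFiltered_poly ?_ hx
  exact Degeneration.isFiltered_trivial D' _ hc

/-- The generators `x, y, t, z`. -/
noncomputable def generator {k : Type*} [Field k] (e : k) : Fin 4 → RussellModel e :=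
  ![RussellModel.x e, RussellModel.y e, RussellModel.t e, RussellModel.z e]

/-- The weights of the generators. -/
def weight {k : Type*} [Field k] {e : k} (W : RussellWeight e) : Fin 4 → ℚ :=
  ![W.wx, W.wy, W.wt, W.wz]

theorem generator_mem {k : Type*} [Field k] {e : k} (W : RussellWeight e) (i : Fin 4) :
    generator e i ∈ W.degeneration.fil (W.weight i) := by
  fin_cases i
  exacts [W.x_mem, W.y_mem, W.t_mem, W.z_mem]

theorem adjoin_range_generator {k : Type*} [Field k] (e : k) :
    Algebra.adjoin k (Set.range (generator e)) = ⊤ := by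
  rw [eq_top_iff]
  intro a _
  have hmem := fun i => Algebra.subset_adjoin (R := k) (Set.mem_range_self (f := generator e) i)
  exact RussellModel.mem_of_generators _ (hmem 0) (hmem 1) (hmem 2) (hmem 3) a

theorem algebraMap_mem {k : Type*} [Field k] {e : k} (W : RussellWeight e) (c : k) :
    algebraMap k (RussellModel e) c ∈ W.degeneration.fil 0 := by
  rw [← (RussellModel.ofPoly e).commutes]
  exact W.ofPoly_mem (W.C_C_C_mem c)

theorem comp_algebraMap {k : Type*} [Field k] {e : k} (W : RussellWeight e) (c : k) :
    W.degeneration.comp 0 (algebraMap k (RussellModel e) c) = algebraMap k _ c := by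
  rw [← (RussellModel.ofPoly e).commutes, ← (RussellModel.ofPoly 0).commutes, comp_ofPoly]
  exact congrArg _ (W.comp_C_C_C c)

theorem exists_isExponentialMap.{u} {k : Type u} [Field k] {e : k} (W : RussellWeight e)
    {φ : RussellModel e →ₐ[k] (RussellModel e)[X]} (h : IsExponentialMap φ)
    (hφ : expInvariants φ ≠ ⊤) :
    ∃ ψ : RussellModel (0 : k) →ₐ[k] (RussellModel (0 : k))[X], IsExponentialMap ψ ∧
      expInvariants ψ ≠ ⊤ ∧ ∀ n, ∀ a ∈ W.degeneration.fil n, a ∈ expInvariants φ →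
        W.degeneration.comp n a ∈ expInvariants ψ := by
  refine Degeneration.exists_isExponentialMap W.hasAssociatedMaps
    W.algebraMap_mem W.comp_algebraMap W.generator_mem (adjoin_range_generator e) ?_ h hφ
  intro D' φ hc hg
  exact W.isFiltered_degeneration D' φ hc (hg 0) (hg 1) (hg 2) (hg 3)

/-- The weights `-1, 2, 0, 0` of `x, y, t, z`. -/
def first {k : Type*} [Field k] (e : k) : RussellWeight e :=
  ⟨-1, 2, 0, 0, by norm_num, by norm_num, Or.inr (by norm_num)⟩

/-- The weights `3, 0, 2, 3` of `x, y, t, z`. -/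
def second (k : Type*) [Field k] : RussellWeight (0 : k) :=
  ⟨3, 0, 2, 3, by norm_num, by norm_num, Or.inl rfl⟩

end RussellWeight

/-! ### Components for the two weight systems -/

section Divisibility

variable {k : Type*} [Field k]

theorem C_C_X_dvd_iff {p : k[X][X][X]} :
    C (C X) ∣ p ↔ ∀ b j, ((p.coeff b).coeff j).coeff 0 = 0 := by
  simp only [C_dvd_iff_dvd_coeff, X_dvd_iff]

theorem C_X_dvd_iff {p : k[X][X][X]} :
    C X ∣ p ↔ ∀ b i, ((p.coeff b).coeff 0).coeff i = 0 := by
  simp only [C_dvd_iff_dvd_coeff, X_dvd_iff, Polynomial.ext_iff, coeff_zero]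

namespace RussellModel

variable {e : k}

theorem ofPoly_dvd {p : k[X][X][X]} {a : RussellModel e} (hre : p ∣ a.re) (him : p ∣ a.im) :
    ofPoly e p ∣ a := by
  rw [eq_add_mul_z a]
  exact dvd_add (_root_.map_dvd _ hre) ((_root_.map_dvd _ him).mul_right _)

theorem ofPoly_mem_of_coeff {S : Subalgebra k (RussellModel e)} {p : k[X][X][X]}
    (h : ∀ b j i, ((p.coeff b).coeff j).coeff i ≠ 0 → x e ^ i * y e ^ j * t e ^ b ∈ S) :
    ofPoly e p ∈ S := by
  rw [p.as_sum_support_C_mul_X_pow, map_sum]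
  refine sum_mem fun b _ => ?_
  rw [(p.coeff b).as_sum_support_C_mul_X_pow, map_sum, Finset.sum_mul, map_sum]
  refine sum_mem fun j _ => ?_
  rw [((p.coeff b).coeff j).as_sum_support_C_mul_X_pow, map_sum, Finset.sum_mul, map_sum,
    Finset.sum_mul, map_sum]
  refine sum_mem fun i hi => ?_
  have h1 := S.smul_mem (h b j i (mem_support_iff.1 hi)) (((p.coeff b).coeff j).coeff i)
  convert h1 using 1
  rw [Algebra.smul_def, map_mul, map_mul, map_mul, map_mul, map_mul, map_mul, map_pow, map_pow,
    map_pow, map_pow, map_pow, map_pow, ← mul_assoc, ← mul_assoc]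
  rfl

/-- A monomial without x has weight 2j, so in degree at most 0 it has weight exactly 0 and would
survive in the component. -/
theorem x_dvd_of_first_comp_eq_zero {a : RussellModel e}
    (ha : a ∈ (RussellWeight.first e).degeneration.fil 0)
    (h0 : (RussellWeight.first e).degeneration.comp 0 a = 0) : x e ∣ a := by
  have key : ∀ p : k[X][X][X], p ∈ (RussellWeight.first e).polyDegeneration.fil 0 →
      (RussellWeight.first e).polyDegeneration.comp 0 p = 0 → C (C X) ∣ p := by
    intro p hp hp0
    rw [C_C_X_dvd_iff]
    intro b j
    by_contra hne
    have h1 := (RussellWeight.mem_polyDegeneration_fil _).1 hp b j 0 hne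
    have h2 := RussellWeight.coeff_polyDegeneration_comp (RussellWeight.first e) 0 p b j 0
    simp only [RussellWeight.first] at h1
    rw [hp0, if_pos] at h2
    · exact hne (by simpa using h2.symm)
    · simp only [RussellWeight.first]
      have : (0 : ℚ) ≤ j := Nat.cast_nonneg j
      push_cast at h1 ⊢
      linarith
  rw [RussellWeight.mem_degeneration_fil] at ha
  rw [RussellWeight.degeneration_comp] at h0
  have hz : (RussellWeight.first e).wz = 0 := rfl
  rw [hz, sub_zero] at ha h0
  exact ofPoly_dvd (key _ ha.1 (congrArg QuadraticAlgebra.re h0))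
    (key _ ha.2 (congrArg QuadraticAlgebra.im h0))

/-- A monomial of weight 2j - i > 0 must involve y. -/
theorem y_dvd_first_comp {n : ℚ} (hn : 0 < n) (a : RussellModel e) :
    y 0 ∣ (RussellWeight.first e).degeneration.comp n a := by
  have key : ∀ p : k[X][X][X], C X ∣ (RussellWeight.first e).polyDegeneration.comp n p := by
    intro p
    rw [C_X_dvd_iff]
    intro b i
    rw [RussellWeight.coeff_polyDegeneration_comp, if_neg]
    simp only [RussellWeight.first]
    have : (0 : ℚ) ≤ i := Nat.cast_nonneg i
    push_cast
    intro h
    linarith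
  refine ofPoly_dvd (key _) ?_
  have hz : n - (RussellWeight.first e).wz = n := sub_zero n
  rw [RussellWeight.degeneration_comp, hz]
  exact key _

/-- Weight 0 means i = 2j, so x and y enter only through x²y = -(t³ + z²). -/
theorem first_comp_zero_mem (a : RussellModel e) :
    (RussellWeight.first e).degeneration.comp 0 a ∈
      Algebra.adjoin k {t (0 : k), z (0 : k)} := by
  have ht : t (0 : k) ∈ Algebra.adjoin k {t (0 : k), z (0 : k)} :=
    Algebra.subset_adjoin (by simp)
  have hz : z (0 : k) ∈ Algebra.adjoin k {t (0 : k), z (0 : k)} :=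
    Algebra.subset_adjoin (by simp)
  have hxy : x (0 : k) ^ 2 * y 0 ∈ Algebra.adjoin k {t (0 : k), z (0 : k)} := by
    have : x (0 : k) ^ 2 * y 0 = -(t 0 ^ 3 + z 0 * z 0) := by
      rw [z_mul_z, map_zero, zero_mul]
      ring
    rw [this]
    exact neg_mem (add_mem (pow_mem ht 3) (mul_mem hz hz))
  have key : ∀ p : k[X][X][X], ofPoly 0 ((RussellWeight.first e).polyDegeneration.comp 0 p) ∈
      Algebra.adjoin k {t (0 : k), z (0 : k)} := by
    intro p
    refine ofPoly_mem_of_coeff fun b j i hne => ?_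
    rw [RussellWeight.coeff_polyDegeneration_comp] at hne
    have h1 := (ite_ne_right_iff.1 hne).1
    simp only [RussellWeight.first] at h1
    have h2 : (i : ℚ) = ((2 * j : ℕ) : ℚ) := by push_cast; linarith
    rw [Nat.cast_inj.1 h2, pow_mul, ← mul_pow]
    exact mul_mem (pow_mem hxy j) (pow_mem ht b)
  rw [eq_add_mul_z ((RussellWeight.first e).degeneration.comp 0 a)]
  have hz' : (0 : ℚ) - (RussellWeight.first e).wz = 0 := sub_zero 0
  rw [RussellWeight.degeneration_comp, hz']
  exact add_mem (key _) (mul_mem (key _) hz)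

/-- The variables x, t, z have positive weight and y has weight 0. -/
theorem mem_adjoin_y_of_mem_second_fil {a : RussellModel (0 : k)}
    (ha : a ∈ (RussellWeight.second k).degeneration.fil 0) : a ∈ Algebra.adjoin k {y (0 : k)} := by
  rw [RussellWeight.mem_degeneration_fil] at ha
  have him : a.im = 0 := by
    refine Polynomial.ext fun b => Polynomial.ext fun j => Polynomial.ext fun i => ?_
    by_contra hne
    have h1 := (RussellWeight.mem_polyDegeneration_fil _).1 ha.2 b j i hne
    simp only [RussellWeight.second] at h1
    have : (0 : ℚ) ≤ i := Nat.cast_nonneg i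
    have : (0 : ℚ) ≤ b := Nat.cast_nonneg b
    linarith
  rw [eq_add_mul_z a, him, map_zero, zero_mul, add_zero]
  refine ofPoly_mem_of_coeff fun b j i hne => ?_
  have h1 := (RussellWeight.mem_polyDegeneration_fil _).1 ha.1 b j i hne
  simp only [RussellWeight.second] at h1
  have hi : (0 : ℚ) ≤ i := Nat.cast_nonneg i
  have hb : (0 : ℚ) ≤ b := Nat.cast_nonneg b
  have hi0 : (i : ℚ) = 0 := by linarith
  have hb0 : (b : ℚ) = 0 := by linarith
  rw [Nat.cast_eq_zero.1 hi0, Nat.cast_eq_zero.1 hb0, pow_zero, pow_zero, one_mul, mul_one]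
  exact pow_mem (Algebra.self_mem_adjoin_singleton k (y 0)) j

end RussellModel

end Divisibility

/-! ### Invariant cubic relations -/

section WeightedCubic

variable {k B : Type*} [Field k] [CommRing B] [Algebra k B] {ψ : B →ₐ[k] B[X]}

/-- Leading terms of distinct degrees cannot cancel. -/
theorem degree_le_degree_sum_of_pairwise_ne {n : ℕ} (F : Fin n → B[X])
    (h : ∀ i j, i ≠ j → F i ≠ 0 → F j ≠ 0 → (F i).natDegree ≠ (F j).natDegree) (i : Fin n) :
    (F i).degree ≤ (∑ j, F j).degree := by
  rw [degree_sum_eq_of_disjoint F Finset.univ]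
  · exact Finset.le_sup (f := fun i => (F i).degree) (Finset.mem_univ i)
  · rintro i ⟨_, hi⟩ j ⟨_, hj⟩ hij heq
    refine h i j hij hi hj ?_
    simp only [Function.comp_apply] at heq
    exact natDegree_eq_of_degree_eq heq

/-- The relation rewrites t³ as γ - α p², so the span of 1, t, t² over polynomials in p is stable
under all generators. The elements multiplying it into itself form a subalgebra, hence the whole
ring. -/
theorem exists_sum_of_relation {p t : B} {α γ : expInvariants ψ}
    (hrel : (α : B) * p ^ 2 + t ^ 3 = γ)
    (hgen : ∀ T : Subalgebra k B, expInvariants ψ ≤ T → p ∈ T → t ∈ T → ∀ a, a ∈ T) (b : B) :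
    ∃ f : Fin 3 → (expInvariants ψ)[X], b = ∑ j, aeval p (f j) * t ^ (j : ℕ) := by
  let M : Set B := {b | ∃ f : Fin 3 → (expInvariants ψ)[X], b = ∑ j, aeval p (f j) * t ^ (j : ℕ)}
  have hadd : ∀ a ∈ M, ∀ b ∈ M, a + b ∈ M := by
    rintro _ ⟨f, rfl⟩ _ ⟨g, rfl⟩
    exact ⟨f + g, by simp [Finset.sum_add_distrib, add_mul]⟩
  have hmul : ∀ g : (expInvariants ψ)[X], ∀ a ∈ M, aeval p g * a ∈ M := by
    rintro g _ ⟨f, rfl⟩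
    exact ⟨fun j => g * f j, by simp [Finset.mul_sum, mul_assoc]⟩
  have ht : ∀ a ∈ M, t * a ∈ M := by
    rintro _ ⟨f, rfl⟩
    refine ⟨![f 2 * (C γ - C α * X ^ 2), f 0, f 1], ?_⟩
    simp only [Fin.sum_univ_three, Matrix.cons_val, map_mul, map_sub, map_pow, aeval_C, aeval_X,
      Fin.val_zero, Fin.val_one, Fin.val_two]
    have h1 : algebraMap (expInvariants ψ) B γ = (γ : B) := rfl
    have h2 : algebraMap (expInvariants ψ) B α = (α : B) := rfl
    rw [h1, h2]
    linear_combination aeval p (f 2) * hrel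
  let T : Subalgebra k B :=
    { carrier := {a | ∀ m ∈ M, a * m ∈ M}
      mul_mem' := fun {a b} ha hb m hm => by rw [mul_assoc]; exact ha _ (hb _ hm)
      add_mem' := fun {a b} ha hb m hm => by rw [add_mul]; exact hadd _ (ha _ hm) _ (hb _ hm)
      algebraMap_mem' := fun c m hm => by
        have := hmul (C (algebraMap k _ c)) m hm
        rwa [aeval_C] at this }
  have hb : b ∈ T := by
    refine hgen T (fun s hs m hm => ?_) (fun m hm => ?_) (fun m hm => ht m hm) b
    · have := hmul (C ⟨s, hs⟩) m hm
      rwa [aeval_C] at this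
    · have := hmul X m hm
      rwa [aeval_X] at this
  have h1 : (1 : B) ∈ M := ⟨![1, 0, 0], by simp [Fin.sum_univ_three]⟩
  have := hb 1 h1
  rwa [mul_one] at this

/-- If 2 = 0, then `h4` reads E² = 0. Otherwise `h2` gives M = 0 and `h5` becomes E³ = 0. -/
theorem eq_zero_of_cubic_relation {R : Type*} [CommRing R] [IsDomain R] {α L M E : R} (hα : α ≠ 0)
    (h2 : 2 * α * M = 0) (h4 : 2 * α * L * M + 3 * E ^ 2 = 0)
    (h5 : α * M ^ 2 + E ^ 3 = 0) : E = 0 := by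
  by_cases h : (2 : R) = 0
  · have : E ^ 2 = 0 := by linear_combination h4 - (α * L * M + E ^ 2) * h
    exact pow_eq_zero_iff (two_ne_zero) |>.1 this
  · have hM : M = 0 := by simpa [h, hα] using h2
    rw [hM] at h5
    have : E ^ 3 = 0 := by linear_combination h5
    exact pow_eq_zero_iff (three_ne_zero) |>.1 this

theorem exists_eq_map_mul_C_add_map {R : Type*} [CommRing R] (S : Subring R) (t : R) (F : R[X])
    (h : ∀ i, ∃ l m : S, F.coeff i = l * t + m) :
    ∃ L M : S[X], F = L.map S.subtype * C t + M.map S.subtype := by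
  choose l m hlm using h
  refine ⟨∑ i ∈ F.support, monomial i (l i), ∑ i ∈ F.support, monomial i (m i), ?_⟩
  conv_lhs => rw [F.as_sum_support]
  rw [Polynomial.map_sum, Polynomial.map_sum, Finset.sum_mul, ← Finset.sum_add_distrib]
  refine Finset.sum_congr rfl fun i _ => ?_
  rw [hlm, Polynomial.map_monomial, Polynomial.map_monomial, monomial_mul_C, ← map_add]
  rfl

/-- If `α p ^ 2 + t ^ 3` is invariant, with `α` invariant, and `p` and `t` generate the ring over
the invariants, then `t` is invariant. -/
theorem IsExponentialMap.mem_of_cubic_relation [IsDomain B] (h : IsExponentialMap ψ) {p t : B}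
    {α γ : expInvariants ψ} (hα : α ≠ 0) (hrel : (α : B) * p ^ 2 + t ^ 3 = γ)
    (hgen : ∀ T : Subalgebra k B, expInvariants ψ ≤ T → p ∈ T → t ∈ T → ∀ a, a ∈ T) :
    t ∈ expInvariants ψ := by
  by_contra htS
  have hαB : (α : B) ≠ 0 := fun h0 => hα (Subtype.ext h0)
  have hm : (ψ t).natDegree ≠ 0 := fun h0 => htS (h.mem_iff_natDegree.2 h0)
  have hrel' : C (α : B) * ψ p ^ 2 + ψ t ^ 3 = C (γ : B) := by
    have h1 : ψ (α : B) = C (α : B) := α.2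
    have h2 : ψ (γ : B) = C (γ : B) := γ.2
    rw [← h1, ← h2, ← hrel, map_add, map_mul, map_pow, map_pow]
  -- The invariant γ affects only the constant term, so α p² and t³ have equal degree; thus p has
  -- degree 3d and t has degree 2d.
  have hdeg : 2 * (ψ p).natDegree = 3 * (ψ t).natDegree := by
    have h1 : C (α : B) * ψ p ^ 2 = -(ψ t ^ 3) + C (γ : B) := by linear_combination hrel'
    have h2 := congrArg natDegree h1
    rwa [natDegree_C_mul hαB, natDegree_add_C, natDegree_neg, natDegree_pow, natDegree_pow] at h2
  obtain ⟨d, hd⟩ : ∃ d, (ψ t).natDegree = 2 * d := ⟨(ψ p).natDegree - (ψ t).natDegree, by omega⟩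
  have hdp : (ψ p).natDegree = 3 * d := by omega
  have hd0 : 0 < d := by omega
  have hpS : p ∉ expInvariants ψ := by
    rw [h.mem_iff_natDegree]
    omega
  have hψ0 : ∀ a, a ≠ 0 → ψ a ≠ 0 := by
    intro a ha h0
    apply ha
    rw [← h.coeff_zero a, h0, Polynomial.coeff_zero]
  have ht0 : t ≠ 0 := fun h0 => htS (h0 ▸ zero_mem _)
  have hterm : ∀ (f : (expInvariants ψ)[X]) (j : ℕ), f ≠ 0 →
      (ψ (aeval p f * t ^ j)).natDegree = f.natDegree * (3 * d) + j * (2 * d) := by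
    intro f j hf
    have h1 : aeval p f ≠ 0 := fun h0 => hf ((h.aeval_eq_zero_iff hpS f).1 h0)
    rw [map_mul, natDegree_mul (hψ0 _ h1) (by rw [map_pow]; exact pow_ne_zero _ (hψ0 _ ht0)),
      natDegree_apply_aeval, map_pow, natDegree_pow, hdp, hd]
  have hterm0 : ∀ (f : (expInvariants ψ)[X]) (j : ℕ), ψ (aeval p f * t ^ j) ≠ 0 → f ≠ 0 := by
    rintro f j h0 rfl
    simp at h0
  -- The terms of the normal form have degrees (3n + 2j)d with j < 3, and 3n + 2j determines n and
  -- j. Nothing cancels, so below degree 3d only invariant combinations of 1 and t remain.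
  have hlow : ∀ b : B, (ψ b).natDegree < 3 * d → ∃ l m : expInvariants ψ, b = l * t + m ∧
      ((ψ b).natDegree < 2 * d → l = 0) := by
    intro b hb
    obtain ⟨f, hf⟩ := exists_sum_of_relation hrel hgen b
    have hle : ∀ j, f j ≠ 0 → (f j).natDegree * (3 * d) + j * (2 * d) ≤ (ψ b).natDegree := by
      intro j hj
      have h1 := degree_le_degree_sum_of_pairwise_ne
        (fun j : Fin 3 => ψ (aeval p (f j) * t ^ (j : ℕ))) (fun i j hij hi hj heq => ?_) j
      · rw [← map_sum, ← hf] at h1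
        rw [← hterm _ _ hj]
        exact natDegree_le_natDegree h1
      · have hi' := hterm0 _ _ hi
        have hj' := hterm0 _ _ hj
        simp only [hterm _ _ hi', hterm _ _ hj'] at heq
        have h2 : (f i).natDegree * 3 + i * 2 = (f j).natDegree * 3 + j * 2 := by
          refine Nat.eq_of_mul_eq_mul_right hd0 ?_
          linarith
        exact hij (Fin.ext (by omega))
    have hconst : ∀ j, ∃ c : expInvariants ψ, f j = C c := by
      intro j
      refine ⟨_, eq_C_of_natDegree_eq_zero ?_⟩
      by_cases hj : f j = 0
      · rw [hj, natDegree_zero]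
      · have h1 := hle j hj
        by_contra h0
        have : 1 * (3 * d) ≤ (f j).natDegree * (3 * d) :=
          Nat.mul_le_mul_right _ (Nat.one_le_iff_ne_zero.2 h0)
        omega
    have h2 : f 2 = 0 := by
      by_contra h0
      have := hle 2 h0
      simp only [Fin.val_two] at this
      omega
    obtain ⟨c0, hc0⟩ := hconst 0
    obtain ⟨c1, hc1⟩ := hconst 1
    refine ⟨c1, c0, ?_, fun hlt => ?_⟩
    · rw [hf, Fin.sum_univ_three, h2, hc0, hc1, aeval_C, aeval_C]
      simp only [map_zero, Fin.val_zero, Fin.val_one, pow_zero, pow_one, mul_one, zero_mul,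
        add_zero]
      exact add_comm _ _
    · by_contra h0
      have := hle 1 (by rw [hc1]; exact C_ne_zero.2 h0)
      simp only [Fin.val_one] at this
      omega
  let S : Subring B := (expInvariants ψ).toSubring
  -- The coefficients of ψ(t) - t have degree below 2d and are thus invariant; those of ψ(p) - p
  -- have degree below 3d and thus lie in S t + S.
  have hE : ∃ E : S[X], ψ t = C t + E.map S.subtype := by
    have h1 : ψ t - C t ∈ Polynomial.lifts S.subtype := by
      rw [lifts_iff_coeff_lifts]
      intro i
      rcases Nat.eq_zero_or_pos i with rfl | hi
      · rw [coeff_sub, h.coeff_zero, coeff_C_zero, sub_self]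
        exact ⟨0, map_zero _⟩
      · rw [coeff_sub, coeff_C_of_ne_zero hi.ne', sub_zero]
        have h2 := h.natDegree_map_coeff_le t i
        obtain ⟨l, m, hlm, hl⟩ := hlow _ (show (ψ ((ψ t).coeff i)).natDegree < 3 * d by omega)
        rw [hl (by omega)] at hlm
        exact ⟨⟨m, m.2⟩, by rw [hlm]; simp⟩
    obtain ⟨E, hE⟩ := (mem_lifts _).1 h1
    exact ⟨E, by rw [hE]; ring⟩
  have hLM : ∃ L M : S[X], ψ p = C p + (L.map S.subtype * C t + M.map S.subtype) := by
    obtain ⟨L, M, hLM⟩ := exists_eq_map_mul_C_add_map S t (ψ p - C p) fun i => by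
      rcases Nat.eq_zero_or_pos i with rfl | hi
      · rw [coeff_sub, h.coeff_zero, coeff_C_zero, sub_self]
        exact ⟨0, 0, by simp⟩
      · rw [coeff_sub, coeff_C_of_ne_zero hi.ne', sub_zero]
        have h2 := h.natDegree_map_coeff_le p i
        obtain ⟨l, m, hlm, _⟩ := hlow _ (show (ψ ((ψ p).coeff i)).natDegree < 3 * d by omega)
        exact ⟨⟨l, l.2⟩, ⟨m, m.2⟩, hlm⟩
    exact ⟨L, M, by rw [← hLM]; ring⟩
  obtain ⟨E, hE⟩ := hE
  obtain ⟨L, M, hLM⟩ := hLM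
  -- The elements 1, t, p, t², pt have degrees 0, 2, 3, 4, 5 times d, which makes them independent
  -- over S.
  have hind : ∀ a : Fin 5 → S, (a 0 : B) + a 1 * t + a 2 * p + a 3 * t ^ 2 + a 4 * (p * t) = 0 →
      ∀ i, a i = 0 := by
    intro a ha i
    let F : Fin 5 → B[X] := fun i => ψ (aeval p (![C (a 0), C (a 1), C (a 2) * X, C (a 3),
      C (a 4) * X] i : (expInvariants ψ)[X]) * t ^ (![0, 1, 0, 2, 1] i : ℕ))
    have hcoe : ∀ s : S, algebraMap S B s = (s : B) := fun s => rfl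
    have hsum : ∑ i, F i = 0 := by
      rw [← map_zero ψ, ← ha, ← map_sum]
      congr 1
      simp only [Fin.sum_univ_five, Matrix.cons_val, map_mul, aeval_C, aeval_X, hcoe]
      ring
    have hd5 : ∀ i, F i ≠ 0 → (F i).natDegree = (![0, 2, 3, 4, 5] i : ℕ) * d := by
      intro i hi
      have hi' := hterm0 _ _ hi
      have h1 := hterm _ (![0, 1, 0, 2, 1] i : ℕ) hi'
      refine h1.trans ?_
      fin_cases i
      · simp
      · simp
      · have : a 2 ≠ 0 := by rintro h0; simp [h0] at hi'
        simp [natDegree_C_mul_X _ this]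
      · simp; ring
      · have : a 4 ≠ 0 := by rintro h0; simp [h0] at hi'
        simp [natDegree_C_mul_X _ this]; ring
    have h1 := degree_le_degree_sum_of_pairwise_ne F (fun i j hij hi hj heq => ?_) i
    · rw [hsum, degree_zero, le_bot_iff, degree_eq_bot] at h1
      by_contra h0
      refine hψ0 _ ?_ h1
      refine mul_ne_zero (fun h2 => h0 ?_) (pow_ne_zero _ ht0)
      have h3 := (h.aeval_eq_zero_iff hpS _).1 h2
      fin_cases i <;> simpa using h3
    · rw [hd5 i hi, hd5 j hj] at heq
      have := Nat.eq_of_mul_eq_mul_right hd0 heq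
      revert this hij
      fin_cases i <;> fin_cases j <;> simp
  have hindX : ∀ a : Fin 5 → S[X], (a 0).map S.subtype + (a 1).map S.subtype * C t +
      (a 2).map S.subtype * C p + (a 3).map S.subtype * C (t ^ 2) +
      (a 4).map S.subtype * C (p * t) = 0 → ∀ i, a i = 0 := by
    intro a ha i
    ext1 n
    refine hind (fun i => (a i).coeff n) ?_ i
    have h1 := congrArg (fun q => q.coeff n) ha
    simp only [coeff_add, coeff_mul_C, Polynomial.coeff_map] at h1
    exact h1
  let α' : S := α
  have hα' : (C α' : S[X]).map S.subtype = C (α : B) := by rw [Polynomial.map_C]; rfl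
  -- Expansion of α(p + Lt + M)² + (t + E)³ = α p² + t³, sorted by 1, t, p, t², pt.
  have hfin := hindX ![C α' * M ^ 2 + E ^ 3, 2 * C α' * L * M + 3 * E ^ 2, 2 * C α' * M,
    C α' * L ^ 2 + 3 * E, 2 * C α' * L] (by
      have h0 : C (γ : B) = C (α : B) * C p ^ 2 + C t ^ 3 := by
        rw [← hrel]
        simp
      rw [hE, hLM, h0] at hrel'
      simp only [Matrix.cons_val, Polynomial.map_add, Polynomial.map_mul, Polynomial.map_pow, hα',
        Polynomial.map_ofNat, C_pow, C_mul]
      linear_combination hrel')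
  have hE0 : E = 0 := eq_zero_of_cubic_relation (R := S[X]) (C_ne_zero.2 hα) (hfin 2) (hfin 1)
    (hfin 0)
  rw [hE0, Polynomial.map_zero, add_zero] at hE
  exact htS hE

end WeightedCubic

/-! ### Linear factors of binary forms -/

section BinaryForms

variable {k R : Type*} [Field k] [CommRing R] [Algebra k R]

/-- The homogenization of degree `n` of `f`, evaluated at `u, v`. -/
noncomputable def homogenizedEval (u v : R) (n : ℕ) (f : k[X]) : R :=
  ∑ l ∈ Finset.range (n + 1), algebraMap k R (f.coeff l) * u ^ l * v ^ (n - l)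

theorem homogenizedEval_succ_of_coeff_eq_zero (u v : R) (n : ℕ) {f : k[X]}
    (hf : f.coeff (n + 1) = 0) :
    homogenizedEval u v (n + 1) f = v * homogenizedEval u v n f := by
  rw [homogenizedEval, Finset.sum_range_succ, hf, map_zero, zero_mul, zero_mul, add_zero,
    homogenizedEval, Finset.mul_sum]
  refine Finset.sum_congr rfl fun l hl => ?_
  rw [Nat.succ_sub (Nat.lt_succ_iff.1 (Finset.mem_range.1 hl)), pow_succ]
  ring

theorem homogenizedEval_X_mul (u v : R) (n : ℕ) (f : k[X]) :
    homogenizedEval u v (n + 1) (X * f) = u * homogenizedEval u v n f := by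
  rw [homogenizedEval, Finset.sum_range_succ', homogenizedEval, Finset.mul_sum]
  simp only [coeff_X_mul, coeff_X_mul_zero, map_zero, zero_mul, add_zero, Nat.add_sub_add_right]
  refine Finset.sum_congr rfl fun l _ => ?_
  ring

theorem homogenizedEval_sub (u v : R) (n : ℕ) (f g : k[X]) :
    homogenizedEval u v n (f - g) = homogenizedEval u v n f - homogenizedEval u v n g := by
  simp only [homogenizedEval, coeff_sub, map_sub, sub_mul, Finset.sum_sub_distrib]

theorem homogenizedEval_C_mul (u v : R) (n : ℕ) (c : k) (f : k[X]) :
    homogenizedEval u v n (C c * f) = algebraMap k R c * homogenizedEval u v n f := by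
  simp only [homogenizedEval, coeff_C_mul, map_mul, Finset.mul_sum, mul_assoc]

/-- A vanishing top coefficient gives the factor v; otherwise a root ρ of f gives u - ρv. -/
theorem exists_linear_dvd_homogenizedEval [IsAlgClosed k] (u v : R) {n : ℕ} {f : k[X]}
    (hf : f.natDegree ≤ n + 1) : v ∣ homogenizedEval u v (n + 1) f ∨
      ∃ ρ : k, u - algebraMap k R ρ * v ∣ homogenizedEval u v (n + 1) f := by
  rcases eq_or_ne (f.coeff (n + 1)) 0 with h0 | h0
  · exact Or.inl ⟨_, homogenizedEval_succ_of_coeff_eq_zero u v n h0⟩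
  · right
    have hd : f.natDegree = n + 1 := le_antisymm hf (le_natDegree_of_ne_zero h0)
    have hdeg : f.degree ≠ 0 := by
      intro h
      have := natDegree_eq_zero_iff_degree_le_zero.2 h.le
      omega
    obtain ⟨ρ, hρ⟩ := IsAlgClosed.exists_root f hdeg
    obtain ⟨g, rfl⟩ := dvd_iff_isRoot.2 hρ
    have hg0 : g ≠ 0 := by
      rintro rfl
      simp at h0
    have hg : g.coeff (n + 1) = 0 := by
      refine coeff_eq_zero_of_natDegree_lt ?_
      rw [natDegree_mul (X_sub_C_ne_zero ρ) hg0, natDegree_X_sub_C] at hd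
      omega
    refine ⟨ρ, homogenizedEval u v n g, ?_⟩
    rw [sub_mul, homogenizedEval_sub, homogenizedEval_X_mul, homogenizedEval_C_mul,
      homogenizedEval_succ_of_coeff_eq_zero u v n hg]
    ring

end BinaryForms

/-! ### Factors of bihomogeneous elements -/

section Bihomogeneous

variable {k : Type*} [Field k]

theorem coeff_coeff_coeff_monomial (b j i b' j' i' : ℕ) (c : k) :
    (((monomial b (monomial j (monomial i c)) : k[X][X][X]).coeff b').coeff j').coeff i' =
      if b = b' ∧ j = j' ∧ i = i' then c else 0 := by
  rw [coeff_monomial]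
  split_ifs with h1 h2 h2
  · rw [coeff_monomial, if_pos h2.2.1, coeff_monomial, if_pos h2.2.2]
  · rw [coeff_monomial]
    split_ifs with h3
    · rw [coeff_monomial, if_neg fun h4 => h2 ⟨h1, h3, h4⟩]
    · rfl
  · exact absurd h2.1 h1
  · rfl

/-- The two weight conditions confine the exponents (i, j, b) to a line with direction (2, 1, -3);
the bound on the t-degree leaves only l ≥ 0. -/
theorem eq_sum_of_bihomogeneous {p : k[X][X][X]} {b₀ j₀ i₀ : ℕ} (hb : p.natDegree ≤ b₀)
    (h : ∀ b j i, ((p.coeff b).coeff j).coeff i ≠ 0 →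
      3 * i + 2 * b = 3 * i₀ + 2 * b₀ ∧ 2 * j + i₀ = 2 * j₀ + i) :
    p = ∑ l ∈ Finset.range (b₀ / 3 + 1), monomial (b₀ - 3 * l) (monomial (j₀ + l)
      (monomial (i₀ + 2 * l) (((p.coeff (b₀ - 3 * l)).coeff (j₀ + l)).coeff (i₀ + 2 * l)))) := by
  refine Polynomial.ext fun b => Polynomial.ext fun j => Polynomial.ext fun i => ?_
  simp only [finsetSum_coeff, coeff_coeff_coeff_monomial]
  by_cases h0 : ((p.coeff b).coeff j).coeff i = 0
  · rw [h0, eq_comm]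
    refine Finset.sum_eq_zero fun l _ => ?_
    split_ifs with h1
    · rw [h1.1, h1.2.1, h1.2.2, h0]
    · rfl
  · obtain ⟨h1, h2⟩ := h b j i h0
    have hb' : b ≤ b₀ := by
      refine le_trans (le_natDegree_of_ne_zero fun h3 => h0 ?_) hb
      rw [h3, coeff_zero, coeff_zero]
    obtain ⟨l, hl⟩ : ∃ l, b₀ = b + 3 * l := ⟨(b₀ - b) / 3, by omega⟩
    rw [Finset.sum_eq_single l]
    · have e1 : b₀ - 3 * l = b := by omega
      have e2 : j₀ + l = j := by omega
      have e3 : i₀ + 2 * l = i := by omega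
      rw [e1, e2, e3, if_pos ⟨rfl, rfl, rfl⟩]
    · intro l' _ hne
      rw [if_neg]
      rintro ⟨-, e2, -⟩
      omega
    · intro hl'
      rw [Finset.mem_range] at hl'
      omega

namespace RussellModel

theorem ofPoly_monomial {e : k} (b j i : ℕ) (c : k) :
    ofPoly e (monomial b (monomial j (monomial i c))) =
      algebraMap k _ c * x e ^ i * y e ^ j * t e ^ b := by
  simp only [← C_mul_X_pow_eq_monomial, map_mul, map_pow]
  rfl

/-- Along that line p is a monomial times a binary form in x²y and t³, which has a linear factor
unless it is constant. -/
theorem exists_dvd_of_bihomogeneous [IsAlgClosed k] {e : k} {p : k[X][X][X]} (hp : p ≠ 0)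
    {m n : ℤ} (hn : 0 < n) (h : ∀ b j i : ℕ, ((p.coeff b).coeff j).coeff i ≠ 0 →
      3 * (i : ℤ) + 2 * b = n ∧ 2 * (j : ℤ) - i = m) :
    x e ∣ ofPoly e p ∨ t e ∣ ofPoly e p ∨
      ∃ ρ : k, x e ^ 2 * y e - algebraMap k _ ρ * t e ^ 3 ∣ ofPoly e p := by
  have hlead : p.coeff p.natDegree ≠ 0 := leadingCoeff_ne_zero.2 hp
  set b₀ := p.natDegree with hb₀
  obtain ⟨j₀, hj₀⟩ : ∃ j, (p.coeff b₀).coeff j ≠ 0 := by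
    by_contra! h0
    exact hlead (Polynomial.ext h0)
  obtain ⟨i₀, hi₀⟩ : ∃ i, ((p.coeff b₀).coeff j₀).coeff i ≠ 0 := by
    by_contra! h0
    exact hj₀ (Polynomial.ext h0)
  obtain ⟨h1, h2⟩ := h b₀ j₀ i₀ hi₀
  have hsum := eq_sum_of_bihomogeneous (p := p) (b₀ := b₀) (j₀ := j₀) (i₀ := i₀) le_rfl
    fun b j i hne => by
      obtain ⟨h3, h4⟩ := h b j i hne
      constructor <;> omega
  set J := b₀ / 3 with hJ
  let f : k[X] := ∑ l ∈ Finset.range (J + 1),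
    monomial l (((p.coeff (b₀ - 3 * l)).coeff (j₀ + l)).coeff (i₀ + 2 * l))
  have hf : ∀ l ∈ Finset.range (J + 1),
      f.coeff l = ((p.coeff (b₀ - 3 * l)).coeff (j₀ + l)).coeff (i₀ + 2 * l) := by
    intro l hl
    simp only [f, finsetSum_coeff, coeff_monomial]
    rw [Finset.sum_ite_eq' (Finset.range (J + 1)) l, if_pos hl]
  have hfdeg : f.natDegree ≤ J := by
    refine natDegree_sum_le_of_forall_le _ _ fun l hl => ?_
    exact (natDegree_monomial_le _).trans (Nat.lt_succ_iff.1 (Finset.mem_range.1 hl))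
  have hfac : ofPoly e p = x e ^ i₀ * y e ^ j₀ * t e ^ (b₀ - 3 * J) *
      homogenizedEval (x e ^ 2 * y e) (t e ^ 3) J f := by
    conv_lhs => rw [hsum]
    rw [map_sum, homogenizedEval, Finset.mul_sum]
    refine Finset.sum_congr rfl fun l hl => ?_
    rw [hf l hl, ofPoly_monomial]
    rw [Finset.mem_range] at hl
    have : b₀ - 3 * l = (b₀ - 3 * J) + 3 * (J - l) := by omega
    rw [this]
    ring
  rcases Nat.eq_zero_or_pos i₀ with hi | hi
  · rcases Nat.eq_zero_or_pos J with hJ0 | hJ0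
    -- With i₀ = 0 and a constant form, 2b₀ = n > 0 provides the factor t.
    · right; left
      rw [hfac]
      refine Dvd.dvd.mul_right (Dvd.dvd.mul_left (dvd_pow_self _ ?_) _) _
      omega
    · obtain ⟨J', hJ'⟩ : ∃ J', J = J' + 1 := ⟨J - 1, by omega⟩
      rw [hJ'] at hfdeg hfac
      rcases exists_linear_dvd_homogenizedEval (x e ^ 2 * y e) (t e ^ 3) hfdeg with h3 | ⟨ρ, h3⟩
      · right; left
        rw [hfac]
        exact ((dvd_pow_self _ three_ne_zero).trans h3).mul_left _
      · right; right
        refine ⟨ρ, ?_⟩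
        rw [hfac]
        exact h3.mul_left _
  · left
    rw [hfac]
    exact (((dvd_pow_self _ hi.ne').mul_right _).mul_right _).mul_right _

theorem exists_dvd_first_comp_second_comp [IsAlgClosed k] {m n : ℚ} (hn : 0 < n)
    (a : RussellModel (0 : k)) :
    ∃ b : RussellModel (0 : k), b ∣ (RussellWeight.first 0).degeneration.comp m
      ((RussellWeight.second k).degeneration.comp n a) ∧
      (b = x 0 ∨ b = t 0 ∨ b = z 0 ∨
        ∃ ρ : k, b = x 0 ^ 2 * y 0 - algebraMap k _ ρ * t 0 ^ 3) := by
  have hz1 : m - (RussellWeight.first (0 : k)).wz = m := sub_zero m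
  have key : ∀ (n' : ℚ) (p : k[X][X][X]) (b j i : ℕ),
      ((((RussellWeight.first (0 : k)).polyDegeneration.comp m
        ((RussellWeight.second k).polyDegeneration.comp n' p)).coeff b).coeff j).coeff i ≠ 0 →
      3 * (i : ℚ) + 2 * b = n' ∧ 2 * (j : ℚ) - i = m := by
    intro n' p b j i hne
    rw [RussellWeight.coeff_polyDegeneration_comp] at hne
    obtain ⟨h1, hne⟩ := ite_ne_right_iff.1 hne
    rw [RussellWeight.coeff_polyDegeneration_comp] at hne
    obtain ⟨h2, -⟩ := ite_ne_right_iff.1 hne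
    simp only [RussellWeight.first, RussellWeight.second] at h1 h2
    constructor <;> linarith
  rw [RussellWeight.degeneration_comp, RussellWeight.degeneration_comp, hz1]
  set p := (RussellWeight.first (0 : k)).polyDegeneration.comp m
    ((RussellWeight.second k).polyDegeneration.comp n a.re) with hp
  set q := (RussellWeight.first (0 : k)).polyDegeneration.comp m
    ((RussellWeight.second k).polyDegeneration.comp (n - (RussellWeight.second k).wz) a.im) with hq
  have hp' := key n a.re
  have hq' := key (n - (RussellWeight.second k).wz) a.im
  rw [← hp] at hp'
  rw [← hq] at hq'
  have hz2 : (RussellWeight.second k).wz = 3 := rfl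
  rw [hz2] at hq'
  by_cases hp0 : p = 0
  · refine ⟨z 0, ⟨ofPoly 0 q, ?_⟩, Or.inr (Or.inr (Or.inl rfl))⟩
    rw [hp0, eq_add_mul_z (⟨0, q⟩ : RussellModel (0 : k)), map_zero, zero_add, mul_comm]
  · have hex : ∀ r : k[X][X][X], r ≠ 0 → ∃ b j i, ((r.coeff b).coeff j).coeff i ≠ 0 := by
      intro r hr
      by_contra! h1
      exact hr (Polynomial.ext fun b => Polynomial.ext fun j => Polynomial.ext fun i => h1 b j i)
    obtain ⟨b, j, i, hne⟩ := hex p hp0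
    have h1 := hp' b j i hne
    -- The parts p and q z cannot both occur: the first weight condition makes i - i' odd, the
    -- second makes it even.
    have hq0 : q = 0 := by
      by_contra hq0
      obtain ⟨b', j', i', hne'⟩ := hex q hq0
      have h2 := hq' b' j' i' hne'
      have h3 : (3 * (i : ℤ) + 2 * b : ℤ) = 3 * i' + 2 * b' + 3 := by
        have : (3 * (i : ℚ) + 2 * b) = 3 * i' + 2 * b' + 3 := by linarith
        exact_mod_cast this
      have h4 : (2 * (j : ℤ) - i : ℤ) = 2 * j' - i' := by
        have : (2 * (j : ℚ) - i) = 2 * j' - i' := by linarith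
        exact_mod_cast this
      omega
    have h2 := exists_dvd_of_bihomogeneous (e := (0 : k)) hp0 (m := 2 * (j : ℤ) - i)
      (n := 3 * (i : ℤ) + 2 * b) (by
        have : (0 : ℚ) < 3 * (i : ℚ) + 2 * b := by linarith
        exact_mod_cast this) (fun b' j' i' hne' => by
        have h2 := hp' b' j' i' hne'
        constructor
        · have : (3 * (i' : ℚ) + 2 * b') = 3 * i + 2 * b := by linarith
          exact_mod_cast this
        · have : (2 * (j' : ℚ) - i') = 2 * j - i := by linarith
          exact_mod_cast this)
    rw [hq0]
    rcases h2 with h2 | h2 | ⟨ρ, h2⟩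
    · exact ⟨_, h2, Or.inl rfl⟩
    · exact ⟨_, h2, Or.inr (Or.inl rfl)⟩
    · exact ⟨_, h2, Or.inr (Or.inr (Or.inr ⟨ρ, rfl⟩))⟩

end RussellModel

end Bihomogeneous

/-! ### Maps on z² + t³ + x²y = 0 that fix y -/

namespace RussellModel

section Singular

variable {k : Type*} [Field k]

/-- Modulo y the first coordinate of b² = 0 reads re² = t³ im², impossible by parity of the t-degree
unless both coordinates of b vanish. -/
theorem y_dvd_of_mul_sq_eq_sq {a b : RussellModel (0 : k)} (h : y 0 * a ^ 2 = b ^ 2) :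
    y 0 ∣ b := by
  let ev : k[X][X][X] →+* k[X][X] := mapRingHom (evalRingHom 0)
  have hev : ∀ p, ev p = 0 → C X ∣ p := by
    intro p hp
    rw [C_X_dvd_iff]
    intro b i
    have := congrArg (fun q => (q.coeff b).coeff i) hp
    simpa [ev, coeff_zero_eq_eval_zero] using this
  have hc : ev (russellSq 0) = -(X ^ 3) := by
    simp [russellSq, ev]
  have hre := congrArg (fun c : RussellModel (0 : k) => ev c.re) h
  have hy : ∀ c : RussellModel (0 : k), (y 0 * c).re = C X * c.re := by
    intro c
    change (QuadraticAlgebra.C (C X) * c : RussellModel (0 : k)).re = _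
    rw [QuadraticAlgebra.C_mul_eq_smul]
    rfl
  have hX : ev (C X) = 0 := by simp [ev]
  simp only [hy, map_mul, hX, zero_mul] at hre
  rw [sq b, QuadraticAlgebra.re_mul, map_add, map_mul, map_mul, map_mul, hc] at hre
  have h1 : ev b.re ^ 2 = X ^ 3 * ev b.im ^ 2 := by linear_combination -hre
  have h2 := eq_zero_of_sq_eq_mul_sq (by rw [natDegree_X_pow]; decide) h1
  rw [h2] at h1
  have h3 : ev b.re = 0 := by simpa using h1
  exact ofPoly_dvd (hev _ h3) (hev _ h2)

/-- Descent: y divides b, then a, and the quotients satisfy the same equation. -/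
theorem y_pow_dvd_of_mul_sq_eq_sq (n : ℕ) : ∀ {a b : RussellModel (0 : k)},
    y 0 * a ^ 2 = b ^ 2 → y 0 ^ n ∣ a := by
  induction n with
  | zero => intro a b _; simp
  | succ n ih =>
    intro a b h
    obtain ⟨b', rfl⟩ := y_dvd_of_mul_sq_eq_sq h
    have h1 : y 0 * b' ^ 2 = a ^ 2 := mul_left_cancel₀ y_ne_zero (by linear_combination -h)
    obtain ⟨a', rfl⟩ := y_dvd_of_mul_sq_eq_sq h1
    have h2 : y 0 * a' ^ 2 = b' ^ 2 := mul_left_cancel₀ y_ne_zero (by linear_combination -h1)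
    rw [pow_succ']
    exact mul_dvd_mul_left _ (ih h2)

/-- `y` is not a square in the fraction field. -/
theorem eq_zero_of_y_mul_sq_eq_sq {a b : RussellModel (0 : k)} (h : y 0 * a ^ 2 = b ^ 2) :
    a = 0 := by
  have h1 : ∀ n, C (X ^ n) ∣ a.re ∧ C (X ^ n) ∣ a.im := by
    intro n
    have h2 := y_pow_dvd_of_mul_sq_eq_sq n h
    rw [y, ← map_pow, ← C_pow] at h2
    exact QuadraticAlgebra.algebraMap_dvd_iff.1 h2
  have key : ∀ p : k[X][X][X], (∀ n, C (X ^ n) ∣ p) → p = 0 := by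
    intro p hp
    refine Polynomial.ext fun b => Polynomial.ext fun j => ?_
    exact X_pow_dvd_iff.1 ((C_dvd_iff_dvd_coeff _ _).1 (hp (j + 1)) b) j (Nat.lt_succ_self j)
  exact QuadraticAlgebra.ext (key _ fun n => (h1 n).1) (key _ fun n => (h1 n).2)

/-- Since -c is a square in k, a nontrivial zero would make y a square in the fraction field. -/
theorem eq_zero_of_y_mul_sq_add_eq_zero [IsAlgClosed k] {a b : RussellModel (0 : k)} {c : k}
    (hc : c ≠ 0) (h : y 0 * a ^ 2 + algebraMap k _ c * b ^ 2 = 0) : a = 0 ∧ b = 0 := by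
  obtain ⟨d, hd⟩ := IsAlgClosed.exists_pow_nat_eq (-c) zero_lt_two
  have ha : a = 0 := by
    refine eq_zero_of_y_mul_sq_eq_sq (b := algebraMap k _ d * b) ?_
    rw [mul_pow, ← map_pow, hd, map_neg]
    linear_combination h
  refine ⟨ha, ?_⟩
  rw [ha] at h
  have hc' : algebraMap k (RussellModel (0 : k)) c ≠ 0 := by
    rwa [Ne, FaithfulSMul.algebraMap_eq_zero_iff]
  simpa [hc'] using h

variable {ψ : RussellModel (0 : k) →ₐ[k] (RussellModel (0 : k))[X]}

/-- If N > 0, the coefficient of degree 2N is the anisotropic form in the N-th coefficients, at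
least one of which is nonzero. -/
theorem mem_of_y_mul_sq_add_mem [IsAlgClosed k] (h : IsExponentialMap ψ)
    (hy : y 0 ∈ expInvariants ψ) {p q : RussellModel (0 : k)} {c : k} (hc : c ≠ 0)
    (hpq : y 0 * p ^ 2 + algebraMap k _ c * q ^ 2 ∈ expInvariants ψ) :
    p ∈ expInvariants ψ ∧ q ∈ expInvariants ψ := by
  set N := max (ψ p).natDegree (ψ q).natDegree with hN
  have h1 : N = 0 := by
    by_contra hN0
    rw [mem_expInvariants_iff] at hy
    have h2 := (h.mem_iff_natDegree.1 hpq)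
    rw [map_add, map_mul, map_mul, map_pow, map_pow, hy, AlgHom.commutes,
      Polynomial.algebraMap_apply] at h2
    have h3 := coeff_eq_zero_of_natDegree_lt (h2.trans_lt (show 0 < 2 * N by omega))
    rw [coeff_add, coeff_C_mul, coeff_C_mul, coeff_pow_of_natDegree_le (le_max_left _ _),
      coeff_pow_of_natDegree_le (le_max_right _ _)] at h3
    obtain ⟨h4, h5⟩ := eq_zero_of_y_mul_sq_add_eq_zero hc h3
    rcases max_choice (ψ p).natDegree (ψ q).natDegree with h6 | h6
    · rw [← hN] at h6
      rw [← hN, h6, coeff_natDegree, leadingCoeff_eq_zero] at h4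
      rw [h4, natDegree_zero] at h6
      exact hN0 h6
    · rw [← hN] at h6
      rw [← hN, h6, coeff_natDegree, leadingCoeff_eq_zero] at h5
      rw [h5, natDegree_zero] at h6
      exact hN0 h6
  rw [h.mem_iff_natDegree, h.mem_iff_natDegree]
  omega

theorem z_sq : z (0 : k) ^ 2 = -(t 0 ^ 3 + x 0 ^ 2 * y 0) := by
  rw [sq, z_mul_z, map_zero, zero_mul, add_zero]

theorem expInvariants_eq_top (h : IsExponentialMap ψ) (hx : x 0 ∈ expInvariants ψ)
    (hy : y 0 ∈ expInvariants ψ) (hz : z 0 ∈ expInvariants ψ) : expInvariants ψ = ⊤ := by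
  have ht : t 0 ∈ expInvariants ψ := by
    refine h.mem_of_pow_mem three_ne_zero ?_
    have : t (0 : k) ^ 3 = -(z 0 ^ 2 + x 0 ^ 2 * y 0) := by rw [z_sq]; ring
    rw [this]
    exact neg_mem (add_mem (pow_mem hz 2) (mul_mem (pow_mem hx 2) hy))
  rw [eq_top_iff]
  exact fun a _ => mem_of_generators _ hx hy ht hz a

/-- The invariant -t³ is the anisotropic form y x² + z². -/
theorem expInvariants_eq_top_of_t_mem [IsAlgClosed k] (h : IsExponentialMap ψ)
    (hy : y 0 ∈ expInvariants ψ) (ht : t 0 ∈ expInvariants ψ) : expInvariants ψ = ⊤ := by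
  have h1 : y 0 * x 0 ^ 2 + algebraMap k _ (1 : k) * z 0 ^ 2 ∈ expInvariants ψ := by
    rw [map_one, one_mul, z_sq, show y 0 * x 0 ^ 2 + -(t 0 ^ 3 + x 0 ^ 2 * y 0) = -(t (0 : k) ^ 3)
      by ring]
    exact neg_mem (pow_mem ht 3)
  obtain ⟨hx, hz⟩ := mem_of_y_mul_sq_add_mem h hy one_ne_zero h1
  exact expInvariants_eq_top h hx hy hz

/-- Here the invariant cubic relation is z² + t³ = -x²y. -/
theorem expInvariants_eq_top_of_x_mem [IsAlgClosed k] (h : IsExponentialMap ψ)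
    (hy : y 0 ∈ expInvariants ψ) (hx : x 0 ∈ expInvariants ψ) : expInvariants ψ = ⊤ := by
  refine expInvariants_eq_top_of_t_mem h hy ?_
  refine h.mem_of_cubic_relation (p := z 0) (α := 1)
    (γ := ⟨-(x 0 ^ 2 * y 0), neg_mem (mul_mem (pow_mem hx 2) hy)⟩) one_ne_zero ?_ ?_
  · change 1 * z (0 : k) ^ 2 + t 0 ^ 3 = -(x 0 ^ 2 * y 0)
    rw [z_sq]
    ring
  · exact fun T hT hz ht => mem_of_generators T (hT hx) (hT hy) ht hz

/-- Here the invariant cubic relation is y x² + t³ = -z², with α = y. -/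
theorem expInvariants_eq_top_of_z_mem [IsAlgClosed k] (h : IsExponentialMap ψ)
    (hy : y 0 ∈ expInvariants ψ) (hz : z 0 ∈ expInvariants ψ) : expInvariants ψ = ⊤ := by
  refine expInvariants_eq_top_of_t_mem h hy ?_
  refine h.mem_of_cubic_relation (p := x 0) (α := ⟨y 0, hy⟩)
    (γ := ⟨-(z 0 ^ 2), neg_mem (pow_mem hz 2)⟩) (fun h0 => y_ne_zero (congrArg Subtype.val h0)) ?_ ?_
  · change y (0 : k) * x 0 ^ 2 + t 0 ^ 3 = -(z 0 ^ 2)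
    rw [z_sq]
    ring
  · exact fun T hT hx ht => mem_of_generators T hx (hT hy) ht (hT hz)

/-- Eliminating t³ turns the element into (1 + ρ)x²y + ρz². The values ρ = 0 and ρ = -1 isolate x
and z; otherwise the form is anisotropic after division by 1 + ρ. -/
theorem expInvariants_eq_top_of_sub_mem [IsAlgClosed k] (h : IsExponentialMap ψ)
    (hy : y 0 ∈ expInvariants ψ) {ρ : k}
    (hρ : x 0 ^ 2 * y 0 - algebraMap k _ ρ * t 0 ^ 3 ∈ expInvariants ψ) :
    expInvariants ψ = ⊤ := by
  rcases eq_or_ne ρ 0 with rfl | h0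
  · rw [map_zero, zero_mul, sub_zero] at hρ
    exact expInvariants_eq_top_of_x_mem h hy
      (h.mem_of_dvd (mul_ne_zero (pow_ne_zero 2 x_ne_zero) y_ne_zero)
        ((dvd_pow_self _ two_ne_zero).mul_right _) hρ)
  rcases eq_or_ne (1 + ρ) 0 with h1 | h1
  · refine expInvariants_eq_top_of_z_mem h hy (h.mem_of_pow_mem two_ne_zero ?_)
    have h2 : algebraMap k (RussellModel (0 : k)) ρ = -1 := by
      rw [← map_one (algebraMap k (RussellModel (0 : k))), ← map_neg]
      congr 1
      linear_combination h1
    rw [h2] at hρ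
    rw [z_sq]
    convert neg_mem hρ using 1
    ring
  · have hc : ρ / (1 + ρ) ≠ 0 := div_ne_zero h0 h1
    have h2 : y 0 * x 0 ^ 2 + algebraMap k _ (ρ / (1 + ρ)) * z 0 ^ 2 ∈ expInvariants ψ := by
      have h3 := (expInvariants ψ).smul_mem hρ (1 / (1 + ρ))
      convert h3 using 1
      have e1 : algebraMap k (RussellModel (0 : k)) (ρ / (1 + ρ)) =
          algebraMap k _ (1 / (1 + ρ)) * algebraMap k _ ρ := by
        rw [← map_mul]
        congr 1
        ring
      have e2 : algebraMap k (RussellModel (0 : k)) (1 / (1 + ρ)) * (1 + algebraMap k _ ρ) = 1 := by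
        rw [← map_one (algebraMap k (RussellModel (0 : k))), ← map_add, ← map_mul]
        congr 1
        field_simp
      rw [Algebra.smul_def, e1, z_sq]
      linear_combination (-(x 0 ^ 2 * y 0)) * e2
    obtain ⟨hx, hz⟩ := mem_of_y_mul_sq_add_mem h hy hc h2
    exact expInvariants_eq_top h hx hy hz

end Singular

end RussellModel

/-! ### Transcendence degree of subalgebras -/

theorem AlgebraicIndependent.exists_notMem_adjoin_singleton {k A : Type*} [Field k] [CommRing A]
    [Algebra k A] {S : Subalgebra k A} {v : Fin 2 → S} (hv : AlgebraicIndependent k v) (y : A) :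
    ∃ a ∈ S, a ∉ Algebra.adjoin k {y} := by
  by_contra! hle
  have hle' : S ≤ Algebra.adjoin k {y} := hle
  rw [Algebra.adjoin_singleton_eq_range_aeval] at hle'
  have h1 := (hv.map' (f := Subalgebra.inclusion hle')
    (Subalgebra.inclusion_injective hle')).lift_cardinalMk_le_trdeg
  have h2 := lift_trdeg_le_of_surjective _ (aeval y : k[X] →ₐ[k] A).rangeRestrict_surjective
  rw [Polynomial.trdeg_of_isDomain, Cardinal.lift_one, Cardinal.lift_le_one_iff] at h2
  have h3 := h1.trans (Cardinal.lift_le.2 h2)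
  simp at h3

theorem trdeg_adjoin_pair_le {k A : Type*} [Field k] [CommRing A] [Algebra k A] (a b : A) :
    Algebra.trdeg k (Algebra.adjoin k {a, b}) ≤ 2 := by
  have h1 : Algebra.adjoin k {a, b} = (MvPolynomial.aeval ![a, b]).range := by
    rw [← Algebra.adjoin_range_eq_range_aeval]
    simp [Set.pair_comm]
  rw [h1]
  have h2 := lift_trdeg_le_of_surjective _
    (MvPolynomial.aeval ![a, b] : MvPolynomial (Fin 2) k →ₐ[k] A).rangeRestrict_surjective
  rw [MvPolynomial.trdeg_of_isDomain] at h2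
  simpa using h2

/-- A subalgebra that is algebraically closed in the ring and contains two algebraically
independent polynomials in `a, b` contains `a` and `b`. -/
theorem adjoin_pair_le_of_algebraicIndependent {k A : Type*} [Field k] [CommRing A] [IsDomain A]
    [Algebra k A] {S : Subalgebra k A} (hS : ∀ c, IsAlgebraic S c → c ∈ S) {a b : A}
    {u : Fin 2 → A} (hu : AlgebraicIndependent k u) (huS : ∀ i, u i ∈ S)
    (hut : ∀ i, u i ∈ Algebra.adjoin k {a, b}) : Algebra.adjoin k {a, b} ≤ S := by
  set T := Algebra.adjoin k {a, b} with hT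
  let u' : Fin 2 → T := fun i => ⟨u i, hut i⟩
  have hu' : AlgebraicIndependent k u' := by
    rw [← AlgHom.algebraicIndependent_iff T.val Subtype.val_injective]
    exact hu
  -- As k[a, b] has transcendence degree at most 2, the two independent elements form a basis, so
  -- everything in k[a, b] is algebraic over them.
  have hbasis : IsTranscendenceBasis k u' := by
    refine hu'.isTranscendenceBasis_of_lift_trdeg_le_of_finite ?_
    simpa using trdeg_adjoin_pair_le (k := k) a b
  have halg := hbasis.isAlgebraic
  have hle : ∀ c ∈ Algebra.adjoin k (Set.range u'), (c : A) ∈ S := by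
    intro c hc
    induction hc using Algebra.adjoin_induction with
    | mem c hc =>
      obtain ⟨i, rfl⟩ := hc
      exact huS i
    | algebraMap r => exact S.algebraMap_mem r
    | add c d _ _ hc hd => exact add_mem hc hd
    | mul c d _ _ hc hd => exact mul_mem hc hd
  let ρ : Algebra.adjoin k (Set.range u') →+* S :=
    ((T.val : T →+* A).comp (algebraMap _ T)).codRestrict S fun c => hle c c.2
  intro c hc
  refine hS c ?_
  obtain ⟨p, hp, hp0⟩ := halg.isAlgebraic (⟨c, hc⟩ : T)
  have hρ : Function.Injective ρ := by
    intro d d' h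
    have h' : ((d : T) : A) = ((d' : T) : A) := congrArg (fun s : S => (s : A)) h
    exact Subtype.ext (Subtype.ext h')
  refine ⟨p.map ρ, (Polynomial.map_ne_zero_iff hρ).2 hp, ?_⟩
  have h1 := congrArg (T.val : T →+* A) hp0
  rw [aeval_def, hom_eval₂] at h1
  rw [aeval_def, eval₂_map]
  exact h1

/-! ### Rigidity and invariance of x -/

namespace RussellModel

section Main

variable {k : Type*} [Field k] [IsAlgClosed k]

theorem expInvariants_eq_top_of_y_mem {ψ : RussellModel (0 : k) →ₐ[k] (RussellModel (0 : k))[X]}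
    (h : IsExponentialMap ψ) (hy : y 0 ∈ expInvariants ψ) : expInvariants ψ = ⊤ := by
  by_contra hne
  obtain ⟨v, hv⟩ := h.exists_algebraicIndependent_pair two_lt_trdeg
  obtain ⟨a, haS, ha⟩ := hv.exists_notMem_adjoin_singleton (y 0)
  obtain ⟨n, hn, hn0⟩ := (RussellWeight.second k).degeneration.exists_lead
    (show a ≠ 0 by rintro rfl; exact ha (zero_mem _))
  have hnpos : 0 < n := by
    by_contra! hle
    exact ha (mem_adjoin_y_of_mem_second_fil ((RussellWeight.second k).degeneration.mono hle hn))
  obtain ⟨ψ₂, h₂, hne₂, hinv₂⟩ := (RussellWeight.second k).exists_isExponentialMap h hne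
  have hy₂ := hinv₂ _ _ (RussellWeight.second k).y_mem hy
  rw [RussellWeight.comp_y] at hy₂
  -- The second degeneration makes the leading form bihomogeneous, while y remains invariant.
  obtain ⟨m, hm, hm0⟩ := (RussellWeight.first (0 : k)).degeneration.exists_lead hn0
  obtain ⟨ψ₃, h₃, hne₃, hinv₃⟩ := (RussellWeight.first (0 : k)).exists_isExponentialMap h₂ hne₂
  have hy₃ := hinv₃ _ _ (RussellWeight.first (0 : k)).y_mem hy₂
  rw [RussellWeight.comp_y] at hy₃
  obtain ⟨b, hb, hcases⟩ := exists_dvd_first_comp_second_comp (m := m) hnpos a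
  have hb₃ := h₃.mem_of_dvd hm0 hb (hinv₃ _ _ hm (hinv₂ _ _ hn haS))
  refine hne₃ ?_
  rcases hcases with rfl | rfl | rfl | ⟨ρ, rfl⟩
  · exact expInvariants_eq_top_of_x_mem h₃ hy₃ hb₃
  · exact expInvariants_eq_top_of_t_mem h₃ hy₃ hb₃
  · exact expInvariants_eq_top_of_z_mem h₃ hy₃ hb₃
  · exact expInvariants_eq_top_of_sub_mem h₃ hy₃ hb₃

theorem x_mem_expInvariants {e : k} {φ : RussellModel e →ₐ[k] (RussellModel e)[X]}
    (h : IsExponentialMap φ) : x e ∈ expInvariants φ := by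
  by_contra hx
  have hne : expInvariants φ ≠ ⊤ := fun h0 => hx (h0 ▸ Algebra.mem_top)
  set W := RussellWeight.first e with hW
  obtain ⟨ψ, hψ, hneψ, hinv⟩ := W.exists_isExponentialMap h hne
  -- A leading form of positive degree would be an invariant divisible by y, against rigidity.
  have hfil : ∀ a ∈ expInvariants φ, a ∈ W.degeneration.fil 0 := by
    intro a ha
    by_cases ha0 : a = 0
    · rw [ha0]
      exact zero_mem _
    obtain ⟨n, hn, hn0⟩ := W.degeneration.exists_lead ha0
    rcases le_or_gt n 0 with hle | hlt
    · exact W.degeneration.mono hle hn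
    · exact absurd (expInvariants_eq_top_of_y_mem hψ
        (hψ.mem_of_dvd hn0 (y_dvd_first_comp hlt a) (hinv n a hn ha))) hneψ
  let χ : expInvariants φ →ₐ[k] RussellModel (0 : k) :=
    { toFun := fun a => W.degeneration.comp 0 (a : RussellModel e)
      map_one' := W.degeneration.comp_one
      map_zero' := map_zero _
      map_mul' := fun a b => by
        have := W.degeneration.comp_mul (hfil a a.2) (hfil b b.2)
        rwa [add_zero] at this
      map_add' := fun a b => map_add _ _ _
      commutes' := fun c => W.comp_algebraMap c }
  have hχ : ∀ a : expInvariants φ, χ a = W.degeneration.comp 0 (a : RussellModel e) :=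
    fun a => rfl
  -- A nonzero invariant in the kernel would be divisible by x, making x invariant.
  have hinj : Function.Injective χ := by
    rw [injective_iff_map_eq_zero]
    intro a ha
    by_contra ha0
    have ha0' : (a : RussellModel e) ≠ 0 := fun h0 => ha0 (Subtype.ext h0)
    exact hx (h.mem_of_dvd ha0' (x_dvd_of_first_comp_eq_zero (hfil a a.2) ha) a.2)
  obtain ⟨v, hv⟩ := h.exists_algebraicIndependent_pair two_lt_trdeg
  have hle := adjoin_pair_le_of_algebraicIndependent (S := expInvariants ψ)
    (fun c hc => hψ.mem_of_isAlgebraic hc) (hv.map' hinj)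
    (fun i => hinv 0 _ (hfil _ (v i).2) (v i).2) (fun i => first_comp_zero_mem _)
  have ht : t 0 ∈ expInvariants ψ := hle (Algebra.subset_adjoin (by simp))
  have hz : z 0 ∈ expInvariants ψ := hle (Algebra.subset_adjoin (by simp))
  have hxy : x 0 ^ 2 * y 0 ∈ expInvariants ψ := by
    have : x (0 : k) ^ 2 * y 0 = -(t 0 ^ 3 + z 0 ^ 2) := by rw [z_sq]; ring
    rw [this]
    exact neg_mem (add_mem (pow_mem ht 3) (pow_mem hz 2))
  exact hneψ (expInvariants_eq_top_of_y_mem hψ (hψ.mem_of_dvd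
    (mul_ne_zero (pow_ne_zero 2 x_ne_zero) y_ne_zero) (dvd_mul_left _ _) hxy))

end Main

/-! ### Two explicit exponential maps and the upper bound -/

section Upper

variable {k : Type*} [Field k] {e : k}

theorem isExponentialMap_of_generators {φ : RussellModel e →ₐ[k] (RussellModel e)[X]}
    (h0 : ∀ a ∈ ({x e, y e, t e, z e} : Set (RussellModel e)), (φ a).eval 0 = a)
    (h1 : ∀ a ∈ ({x e, y e, t e, z e} : Set (RussellModel e)),
      (φ a).map (φ : RussellModel e →+* (RussellModel e)[X]) = aeval (C X + X) (φ a)) :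
    IsExponentialMap φ where
  eval_zero a := by
    have : ((aeval (0 : RussellModel e)).restrictScalars k).comp φ = AlgHom.id k _ :=
      algHom_ext (by simpa [aeval_def] using h0 (x e) (by simp))
        (by simpa [aeval_def] using h0 (y e) (by simp))
        (by simpa [aeval_def] using h0 (t e) (by simp))
        (by simpa [aeval_def] using h0 (z e) (by simp))
    simpa [aeval_def] using DFunLike.congr_fun this a
  comp_eq a := by
    let S : Subalgebra k (RussellModel e) :=
      { carrier := {a | (φ a).map (φ : RussellModel e →+* (RussellModel e)[X]) =
          aeval (C X + X) (φ a)}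
        mul_mem' := fun {a b} ha hb => by
          rw [Set.mem_ofPred_eq] at ha hb ⊢
          rw [map_mul, Polynomial.map_mul, map_mul, ha, hb]
        add_mem' := fun {a b} ha hb => by
          rw [Set.mem_ofPred_eq] at ha hb ⊢
          rw [map_add, Polynomial.map_add, map_add, ha, hb]
        algebraMap_mem' := fun c => by
          rw [Set.mem_ofPred_eq, AlgHom.commutes, Polynomial.algebraMap_apply, Polynomial.map_C,
            aeval_C, RingHom.coe_coe, AlgHom.commutes, Polynomial.algebraMap_apply]
          rfl }
    exact mem_of_generators S (h1 (x e) (by simp)) (h1 (y e) (by simp)) (h1 (t e) (by simp))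
      (h1 (z e) (by simp)) a

/-- The increment carries the factor x² so that the change of z² is divisible by x² and can be
absorbed in y. -/
theorem exists_isExponentialMap_z (e : k) : ∃ φ : RussellModel e →ₐ[k] (RussellModel e)[X],
    IsExponentialMap φ ∧ φ (x e) = C (x e) ∧ φ (t e) = C (t e) ∧
      φ (z e) = C (z e) + C (x e) ^ 2 * X := by
  obtain ⟨φ, hx, hy, ht, hz⟩ := exists_lift (e := e) (C (x e))
    (C (y e) - (2 * C (z e) * X + C (x e) ^ 2 * X ^ 2)) (C (t e)) (C (z e) + C (x e) ^ 2 * X) (by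
      have h := congrArg (C : RussellModel e → (RussellModel e)[X]) (z_mul_z (e := e))
      simp only [map_mul, map_neg, map_add, map_pow] at h
      rw [Polynomial.algebraMap_apply]
      linear_combination h)
  refine ⟨φ, isExponentialMap_of_generators ?_ ?_, hx, ht, hz⟩
  · rintro a (rfl | rfl | rfl | rfl)
    · simp [hx]
    · simp [hy]
    · simp [ht]
    · simp [hz]
  · rintro a (rfl | rfl | rfl | rfl)
    · simp [hx]
    · simp [hy, hx, hz, map_ofNat]
      ring
    · simp [ht]
    · simp [hz, hx]
      ring

theorem exists_isExponentialMap_t (e : k) : ∃ φ : RussellModel e →ₐ[k] (RussellModel e)[X],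
    IsExponentialMap φ ∧ φ (x e) = C (x e) ∧ φ (t e) = C (t e) + C (x e) ^ 2 * X := by
  obtain ⟨φ, hx, hy, ht, hz⟩ := exists_lift (e := e) (C (x e))
    (C (y e) - (3 * C (t e) ^ 2 * X + 3 * C (t e) * C (x e) ^ 2 * X ^ 2 + C (x e) ^ 4 * X ^ 3))
    (C (t e) + C (x e) ^ 2 * X) (C (z e)) (by
      have h := congrArg (C : RussellModel e → (RussellModel e)[X]) (z_mul_z (e := e))
      simp only [map_mul, map_neg, map_add, map_pow] at h
      rw [Polynomial.algebraMap_apply]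
      linear_combination h)
  refine ⟨φ, isExponentialMap_of_generators ?_ ?_, hx, ht⟩
  · rintro a (rfl | rfl | rfl | rfl)
    · simp [hx]
    · simp [hy]
    · simp [ht]
    · simp [hz]
  · rintro a (rfl | rfl | rfl | rfl)
    · simp [hx]
    · simp [hy, hx, ht, map_ofNat]
      ring
    · simp [ht, hx]
      ring
    · simp [hz]

theorem exists_x_pow_mul_mem (a : RussellModel e) :
    ∃ n, x e ^ n * a ∈ Algebra.adjoin k {x e, t e, z e} := by
  have hx : x e ∈ Algebra.adjoin k {x e, t e, z e} := Algebra.subset_adjoin (by simp)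
  have ht : t e ∈ Algebra.adjoin k {x e, t e, z e} := Algebra.subset_adjoin (by simp)
  have hz : z e ∈ Algebra.adjoin k {x e, t e, z e} := Algebra.subset_adjoin (by simp)
  let T : Subalgebra k (RussellModel e) :=
    { carrier := {a | ∃ n, x e ^ n * a ∈ Algebra.adjoin k {x e, t e, z e}}
      mul_mem' := by
        rintro a b ⟨m, hm⟩ ⟨n, hn⟩
        refine ⟨m + n, ?_⟩
        convert mul_mem hm hn using 1
        ring
      add_mem' := by
        rintro a b ⟨m, hm⟩ ⟨n, hn⟩
        refine ⟨m + n, ?_⟩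
        convert add_mem (mul_mem (pow_mem hx n) hm) (mul_mem (pow_mem hx m) hn) using 1
        ring
      algebraMap_mem' := fun c => ⟨0, by
        rw [pow_zero, one_mul]
        exact Subalgebra.algebraMap_mem _ c⟩ }
  have hof : ∀ b ∈ Algebra.adjoin k {x e, t e, z e}, b ∈ T := fun b hb => ⟨0, by
    rwa [pow_zero, one_mul]⟩
  refine mem_of_generators T (hof _ hx) ⟨2, ?_⟩ (hof _ ht) (hof _ hz) a
  have : x e ^ 2 * y e = -(z e * z e + t e ^ 3 + algebraMap k _ e * x e) := by
    rw [z_mul_z]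
    ring
  rw [this]
  exact neg_mem (add_mem (add_mem (mul_mem hz hz) (pow_mem ht 3))
    (mul_mem (Subalgebra.algebraMap_mem _ e) hx))

theorem mem_adjoin_x_of_x_pow_mul_mem {n : ℕ} : ∀ {a : RussellModel e},
    x e ^ n * a ∈ Algebra.adjoin k {x e} → a ∈ Algebra.adjoin k {x e} := by
  induction n with
  | zero => intro a ha; rwa [pow_zero, one_mul] at ha
  | succ n ih =>
    intro a ha
    refine ih ?_
    rw [pow_succ', mul_assoc, Algebra.adjoin_singleton_eq_range_aeval] at ha
    obtain ⟨f, hf⟩ := ha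
    replace hf : aeval (x e) f = x e * (x e ^ n * a) := hf
    -- Evaluation at the origin, a point of the hypersurface, gives f(0) = 0, so a factor x cancels.
    obtain ⟨ε, hx, -⟩ := exists_lift (e := e) (0 : k) 0 0 0 (by simp)
    have h1 := congrArg ε hf
    rw [← aeval_algHom_apply, map_mul, hx, zero_mul, ← coeff_zero_eq_aeval_zero] at h1
    obtain ⟨g, rfl⟩ := X_dvd_iff.2 h1
    rw [map_mul, aeval_X] at hf
    rw [← mul_left_cancel₀ x_ne_zero hf]
    exact aeval_mem_adjoin_singleton k _

end Upper

end RussellModel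

/-! ### Elimination of variables, transfer along isomorphisms, conclusion -/

section Transfer

variable {k A : Type*} [Field k] [CommRing A] [Algebra k A]

/-- A polynomial in the non-invariant p with invariant coefficients is invariant only if it is
constant. -/
theorem IsExponentialMap.mem_of_mem_adjoin_insert [IsDomain A] {φ : A →ₐ[k] A[X]}
    (h : IsExponentialMap φ) {s : Set A} (hs : s ⊆ expInvariants φ) {p b : A}
    (hp : p ∉ expInvariants φ) (hb : b ∈ expInvariants φ)
    (hbs : b ∈ Algebra.adjoin k (insert p s)) : b ∈ Algebra.adjoin k s := by
  have hle : Algebra.adjoin k s ≤ expInvariants φ := Algebra.adjoin_le hs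
  let ι : Algebra.adjoin k s →+* expInvariants φ := Subalgebra.inclusion hle
  have hι : Function.Injective ι := Subalgebra.inclusion_injective hle
  have h1 : ∃ f : (Algebra.adjoin k s)[X], b = aeval p f := by
    have h2 : Algebra.adjoin k (insert p s) ≤
        (aeval p : (Algebra.adjoin k s)[X] →ₐ[Algebra.adjoin k s] A).range.restrictScalars k := by
      refine Algebra.adjoin_le (Set.insert_subset ⟨X, aeval_X p⟩ fun c hc => ?_)
      exact ⟨C ⟨c, Algebra.subset_adjoin hc⟩, aeval_C _ _⟩
    obtain ⟨f, hf⟩ := h2 hbs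
    exact ⟨f, hf.symm⟩
  obtain ⟨f, rfl⟩ := h1
  have h2 : aeval p f = aeval p (f.map ι) := by
    rw [aeval_def, aeval_def, eval₂_map]
    rfl
  have h3 := h.mem_iff_natDegree.1 hb
  rw [h2, IsExponentialMap.natDegree_apply_aeval, Nat.mul_eq_zero,
    or_iff_left (fun h0 => hp (h.mem_iff_natDegree.2 h0)),
    natDegree_map_eq_of_injective hι] at h3
  rw [eq_C_of_natDegree_eq_zero h3, aeval_C]
  exact (f.coeff 0).2

theorem mem_akInvariant_iff {a : A} : a ∈ akInvariant k A ↔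
    ∀ φ : A →ₐ[k] A[X], IsExponentialMap φ → a ∈ expInvariants φ := by
  rw [akInvariant, Algebra.mem_iInf]
  exact ⟨fun h φ hφ => h ⟨φ, hφ⟩, fun h φ => h φ.1 φ.2⟩

theorem symm_apply_mem_akInvariant {B : Type*} [CommRing B] [Algebra k B] (f : A ≃ₐ[k] B) {b : B}
    (hb : b ∈ akInvariant k B) : f.symm b ∈ akInvariant k A := by
  rw [mem_akInvariant_iff] at hb ⊢
  intro φ hφ
  have h1 := hb _ (hφ.conj f)
  rw [mem_expInvariants_iff] at h1 ⊢
  have h2 := congrArg (Polynomial.map (f.symm : B →+* A)) h1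
  rw [Polynomial.map_C] at h2
  simp only [AlgHom.comp_apply, coe_mapAlgHom, Polynomial.map_map] at h2
  have h3 : (f.symm : B →+* A).comp ((f : A →ₐ[k] B) : A →+* B) = RingHom.id A := by
    ext a
    simp
  rw [h3, Polynomial.map_id] at h2
  exact h2

end Transfer

theorem akInvariant_russellModel {k : Type*} [Field k] [IsAlgClosed k] (e : k) :
    akInvariant k (RussellModel e) = Algebra.adjoin k {RussellModel.x e} := by
  refine le_antisymm (fun a ha => ?_) ?_
  · rw [mem_akInvariant_iff] at ha
    obtain ⟨φ, hφ, hx, ht, hz⟩ := RussellModel.exists_isExponentialMap_z e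
    obtain ⟨ψ, hψ, hx', ht'⟩ := RussellModel.exists_isExponentialMap_t e
    obtain ⟨n, hn⟩ := RussellModel.exists_x_pow_mul_mem a
    have hX : ∀ {p : (RussellModel e)[X]} {b : RussellModel e},
        p = C b + C (RussellModel.x e) ^ 2 * X → p ≠ C b := by
      intro p b hp h0
      have := congrArg (fun q => q.coeff 1) (hp.symm.trans h0)
      simp only [coeff_add, coeff_C_succ, ← C_pow, coeff_C_mul_X, if_true, zero_add] at this
      exact pow_ne_zero 2 RussellModel.x_ne_zero this
    have hmem : ∀ {χ : RussellModel e →ₐ[k] (RussellModel e)[X]}, IsExponentialMap χ →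
        χ (RussellModel.x e) = C (RussellModel.x e) →
          RussellModel.x e ^ n * a ∈ expInvariants χ := fun hχ hx =>
      mul_mem (pow_mem (mem_expInvariants_iff.2 hx) n) (ha _ hχ)
    refine RussellModel.mem_adjoin_x_of_x_pow_mul_mem (n := n) ?_
    -- Read backwards: φ removes z from k[x, t, z], then ψ removes t from k[x, t].
    refine hψ.mem_of_mem_adjoin_insert (p := RussellModel.t e)
      (Set.singleton_subset_iff.2 hx') (hX ht') (hmem hψ hx') ?_
    refine hφ.mem_of_mem_adjoin_insert (p := RussellModel.z e)
      (Set.insert_subset ht (Set.singleton_subset_iff.2 hx)) (hX hz) (hmem hφ hx) ?_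
    convert hn using 2
    ext b
    simp only [Set.mem_insert_iff, Set.mem_singleton_iff]
    tauto
  · rw [Algebra.adjoin_le_iff, Set.singleton_subset_iff, SetLike.mem_coe, mem_akInvariant_iff]
    exact fun φ hφ => RussellModel.x_mem_expInvariants hφ

theorem mainTheorem1 (k : Type*) [Field k] [IsAlgClosed k] :
    akInvariant k (RussellRing k) = Algebra.adjoin k {russellX k} := by
  obtain ⟨f, hf⟩ := exists_algEquiv_russellModel k
  have hadj : Algebra.adjoin k {russellX k} =
      (Algebra.adjoin k {RussellModel.x (1 : k)}).map (f : RussellModel (1 : k) →ₐ[k] _) := by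
    rw [AlgHom.map_adjoin, Set.image_singleton]
    exact congrArg (fun a => Algebra.adjoin k {a}) hf.symm
  rw [hadj, ← akInvariant_russellModel]
  ext b
  rw [Subalgebra.mem_map]
  constructor
  · exact fun hb => ⟨f.symm b, symm_apply_mem_akInvariant f hb, f.apply_symm_apply b⟩
  · rintro ⟨a, ha, rfl⟩
    have := symm_apply_mem_akInvariant f.symm ha
    rwa [AlgEquiv.symm_symm] at this
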